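/- Let $\mathbb{H}^+=\{(x,y)\in\mathbb{R}^2 : x>0\}$ and let $m\in\mathbb{C}$. Let $u:\mathbb{H}^+\to\mathbb{C}$ be a function of class $C^2$ (in the real sense) such that $$L_m u(x,y) := \frac{\partial^2 u}{\partial x^2}(x,y)+\frac{\partial^2 u}{\partial y^2}(x,y)+\frac{m}{x}\,\frac{\partial u}{\partial x}(x,y)=0\qquad\text{for all }(x,y)\in\mathbb{H}^+,$$ and such that $\lim_{\partial\mathbb{H}^+}u=0$, in the sense that for every $\varepsilon>0$ there is an integer $N\ge 1$ such that for every integer $n\geq N$ and every $(x,y)\in\mathbb{H}^+$, $$x\leq \frac1n\ \text{ or }\ \sqrt{x^2+y^2}\geq n\quad\Longrightarrow\quad |u(x,y)|\leq\varepsilon .$$ Then $u\equiv 0$ on $\mathbb{H}^+$. -/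

import Mathlib

/-- The open right half-plane `{(x, y) ∈ ℝ² : x > 0}`. The plane `ℝ²` is identified with `ℂ`
through `(x, y) ↦ x + iy`, so that `‖z‖` is the Euclidean norm of `(x, y)`. -/
def rightHalfPlane : Set ℂ := {z : ℂ | 0 < z.re}

/-- The Weinstein operator `L_m u = Δ u + (m / x) ∂u/∂x`, where `z = x + iy`. All derivatives are
real ones: `Δ` is the Laplacian of the real plane and `fderiv ℝ u z 1` is the partial
derivative of `u` with respect to `x`. -/
noncomputable def weinsteinOp (m : ℂ) (u : ℂ → ℂ) (z : ℂ) : ℂ :=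
  Laplacian.laplacian u z + m / (z.re : ℂ) * fderiv ℝ u z 1

/-- `lim_{∂ℍ⁺} u = 0`: the function `u` tends to `0` uniformly at the `y`-axis and at infinity. -/
def TendsToZeroAtBoundary (u : ℂ → ℂ) : Prop :=
  ∀ ε : ℝ, 0 < ε → ∃ N : ℕ, 0 < N ∧ ∀ n : ℕ, N ≤ n → ∀ z ∈ rightHalfPlane,
    (z.re ≤ 1 / (n : ℝ) ∨ (n : ℝ) ≤ ‖z‖) → ‖u z‖ ≤ ε

open MeasureTheory Set Filter Topology

/-! Since `m` is complex there is no maximum principle; the proof is by duality. Write `Q = 1 + x² +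
y²`. The formal adjoint is `L_m^* w = Δw - (m/x) w_x + (m/x²) w`, and `x^κ` is killed by it exactly
when `(κ - 1)(κ - m) = 0`. For such `κ`, `L_m^*(x^κ v) = x^κ L_k v` with `k = 2κ - m`. Taking for
`κ` whichever of `1`, `m` has the larger real part gives `1 ≤ Re κ ≤ Re k`.

Green's identity is applied to `v = y^j Q^(-(k/2 + n))`, first with cutoffs. Near the axis the
cutoff costs `O(δ^(Re κ - 1)) sup |u|` over a strip of width comparable to `δ`
(`integral_mul_cpow_mul_eq_zero`); at infinity it costs `O(1) sup |u|` over `|z| ≥ R`. Both tend to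
`0` because `u` does. As `L_k v` is a combination of functions of the same shape, this yields
`moment_recurrence`, and induction kills all moments `∫ u x^κ y^j Q^(-(k/2 + n))` with `j + 2 ≤ n`
(`integral_momentDensity_eq_zero`).

These are the moments of the integrable density `u x^κ Q^(-(k/2 + 2))` against monomials in the
bounded coordinates `1/Q`, `y/Q`, which separate the points of the half-plane. By Stone–Weierstrass
the density is orthogonal to every test function, so it vanishes, and `u` with it. -/

theorem isOpen_rightHalfPlane : IsOpen rightHalfPlane :=
  isOpen_lt continuous_const Complex.continuous_re

/-! ### Integration by parts and Green's identity -/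

/-- A function continuous on an open set and vanishing off a compact subset is continuous. -/
theorem ContinuousOn.continuous_of_eq_zero_off {F : ℂ → ℂ} {U K : Set ℂ} (hU : IsOpen U)
    (hK : IsClosed K) (hKU : K ⊆ U) (hF : ContinuousOn F U) (h0 : ∀ z ∉ K, F z = 0) :
    Continuous F := by
  rw [continuous_iff_continuousAt]
  intro z
  by_cases hz : z ∈ K
  · exact hF.continuousAt (hU.mem_nhds (hKU hz))
  · have : F =ᶠ[𝓝 z] fun _ => 0 := by
      filter_upwards [hK.isOpen_compl.mem_nhds hz] with y hy using h0 y hy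
    exact continuousAt_const.congr this.symm

theorem ContinuousOn.integrable_of_eq_zero_off {F : ℂ → ℂ} {U K : Set ℂ} (hU : IsOpen U)
    (hK : IsCompact K) (hKU : K ⊆ U) (hF : ContinuousOn F U) (h0 : ∀ z ∉ K, F z = 0) :
    Integrable F :=
  (hF.continuous_of_eq_zero_off hU hK.isClosed hKU h0).integrable_of_hasCompactSupport
    (HasCompactSupport.intro hK h0)

/-- The integral of a directional derivative of a compactly supported function vanishes. -/
theorem integral_lineDeriv_eq_zero_of_eq_zero_off {F F' : ℂ → ℂ} {U K : Set ℂ} {v : ℂ}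
    (hU : IsOpen U) (hK : IsCompact K) (hKU : K ⊆ U) (hF : ContinuousOn F U)
    (hF' : ContinuousOn F' U) (h : ∀ z ∈ U, HasLineDerivAt ℝ F (F' z) z v)
    (h0 : ∀ z ∉ K, F z = 0) (h0' : ∀ z ∉ K, F' z = 0) : ∫ z, F' z = 0 := by
  have hd : ∀ z, HasLineDerivAt ℝ F (F' z) z v := by
    intro z
    by_cases hz : z ∈ K
    · exact h z (hKU hz)
    · rw [h0' z hz]
      have h1 : HasLineDerivAt ℝ (fun _ : ℂ => (0 : ℂ)) 0 z v := by
        simpa [HasLineDerivAt] using hasDerivAt_const (0 : ℝ) (0 : ℂ)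
      refine h1.congr_of_eventuallyEq ?_
      filter_upwards [hK.isClosed.isOpen_compl.mem_nhds hz] with y hy using h0 y hy
  have hi := hF.integrable_of_eq_zero_off hU hK hKU h0
  have hi' := hF'.integrable_of_eq_zero_off hU hK hKU h0'
  -- Integration by parts against the constant function `1`, whose derivative is `0`.
  have := integral_bilinear_hasLineDerivAt_right_eq_neg_left_of_integrable (μ := volume)
    (f := F) (f' := F') (g := fun _ => (1 : ℂ)) (g' := fun _ => (0 : ℂ)) (v := v)
    (B := ContinuousLinearMap.mul ℝ ℂ) (by simpa using hi') (by simp) (by simpa using hi)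
    (fun z _ => hd z) (fun z _ => by
      simpa [HasLineDerivAt] using hasDerivAt_const (0 : ℝ) (1 : ℂ))
  simpa using this.symm

theorem hasLineDerivAt_fderiv_apply {u : ℂ → ℂ} {U : Set ℂ} (hU : IsOpen U)
    (hu : ContDiffOn ℝ 2 u U) {z : ℂ} (hz : z ∈ U) (v : ℂ) :
    HasLineDerivAt ℝ (fun y => fderiv ℝ u y v) (iteratedFDeriv ℝ 2 u z ![v, v]) z v := by
  have h1 : DifferentiableAt ℝ (fderiv ℝ u) z :=
    ((hu.contDiffAt (hU.mem_nhds hz)).fderiv_right (m := 1) (by norm_num)).differentiableAt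
      (by norm_num)
  have h2 := ((ContinuousLinearMap.apply ℝ ℂ v).hasFDerivAt.comp z h1.hasFDerivAt).hasLineDerivAt v
  simpa [iteratedFDeriv_two_apply, Function.comp_def] using h2

theorem continuousOn_fderiv_apply {u : ℂ → ℂ} {U : Set ℂ} (hU : IsOpen U)
    (hu : ContDiffOn ℝ 2 u U) (v : ℂ) : ContinuousOn (fun y => fderiv ℝ u y v) U :=
  (hu.continuousOn_fderiv_of_isOpen hU (by norm_num)).clm_apply continuousOn_const

theorem continuousOn_iteratedFDeriv_two_apply {u : ℂ → ℂ} {U : Set ℂ} (hU : IsOpen U)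
    (hu : ContDiffOn ℝ 2 u U) (v : ℂ) :
    ContinuousOn (fun y => iteratedFDeriv ℝ 2 u y ![v, v]) U := by
  have h1 : ContDiffOn ℝ 1 (fderiv ℝ u) U := hu.fderiv_of_isOpen hU (by norm_num)
  have h2 : ContinuousOn (fun y => fderiv ℝ (fderiv ℝ u) y v v) U :=
    ((h1.continuousOn_fderiv_of_isOpen hU (by norm_num)).clm_apply
      continuousOn_const).clm_apply continuousOn_const
  simpa [iteratedFDeriv_two_apply] using h2

theorem HasLineDerivAt.mul' {f g : ℂ → ℂ} {f' g' z v : ℂ} (hf : HasLineDerivAt ℝ f f' z v)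
    (hg : HasLineDerivAt ℝ g g' z v) :
    HasLineDerivAt ℝ (fun y => f y * g y) (f' * g z + f z * g') z v := by
  have := HasDerivAt.fun_mul (𝕜 := ℝ) hf hg
  simpa [HasLineDerivAt] using this

/-- Green's identity: a solution of `L_m u = 0` is orthogonal to `L_m^* w` for every compactly
supported `w`. -/
theorem integral_mul_adjoint_weinsteinOp_eq_zero {m : ℂ} {u : ℂ → ℂ}
    (hu : ContDiffOn ℝ 2 u rightHalfPlane) (hL : ∀ z ∈ rightHalfPlane, weinsteinOp m u z = 0)
    {K : Set ℂ} (hK : IsCompact K) (hKH : K ⊆ rightHalfPlane) {w wx wy wxx wyy : ℂ → ℂ}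
    (hwx : ∀ z ∈ rightHalfPlane, HasLineDerivAt ℝ w (wx z) z 1)
    (hwy : ∀ z ∈ rightHalfPlane, HasLineDerivAt ℝ w (wy z) z Complex.I)
    (hwxx : ∀ z ∈ rightHalfPlane, HasLineDerivAt ℝ wx (wxx z) z 1)
    (hwyy : ∀ z ∈ rightHalfPlane, HasLineDerivAt ℝ wy (wyy z) z Complex.I)
    (cw : ContinuousOn w rightHalfPlane) (cwx : ContinuousOn wx rightHalfPlane)
    (cwy : ContinuousOn wy rightHalfPlane) (cwxx : ContinuousOn wxx rightHalfPlane)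
    (cwyy : ContinuousOn wyy rightHalfPlane)
    (h0 : ∀ z ∉ K, w z = 0 ∧ wx z = 0 ∧ wy z = 0 ∧ wxx z = 0 ∧ wyy z = 0) :
    ∫ z in rightHalfPlane,
      u z * (wxx z + wyy z - m / (z.re : ℂ) * wx z + m / (z.re : ℂ) ^ 2 * w z) = 0 := by
  have hU := isOpen_rightHalfPlane
  have cu := hu.continuousOn
  have cux := continuousOn_fderiv_apply hU hu 1
  have cuy := continuousOn_fderiv_apply hU hu Complex.I
  have cuxx := continuousOn_iteratedFDeriv_two_apply hU hu 1
  have cuyy := continuousOn_iteratedFDeriv_two_apply hU hu Complex.I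
  have hne : ∀ z ∈ rightHalfPlane, (z.re : ℂ) ≠ 0 := fun z hz => by
    simpa using (show (0 : ℝ) < z.re from hz).ne'
  have cre : ContinuousOn (fun z : ℂ => (z.re : ℂ)) rightHalfPlane :=
    (Complex.continuous_ofReal.comp Complex.continuous_re).continuousOn
  have cinv : ContinuousOn (fun z : ℂ => (z.re : ℂ)⁻¹) rightHalfPlane := cre.inv₀ hne
  have hud : ∀ z ∈ rightHalfPlane, ∀ v, HasLineDerivAt ℝ u (fderiv ℝ u z v) z v := fun z hz v =>
    ((hu.contDiffAt (hU.mem_nhds hz)).differentiableAt (by norm_num)).hasFDerivAt.hasLineDerivAt v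
  have hre : ∀ z ∈ rightHalfPlane, HasLineDerivAt ℝ (fun z : ℂ => (z.re : ℂ)⁻¹)
      (-((z.re : ℂ) ^ 2)⁻¹) z 1 := by
    intro z hz
    have h1 : HasDerivAt (fun t : ℝ => ((z.re + t : ℝ) : ℂ)) 1 0 := by
      simpa using ((hasDerivAt_id (0 : ℝ)).const_add z.re).ofReal_comp
    have h2 := h1.fun_inv (by simpa using hne z hz)
    simpa [HasLineDerivAt, div_eq_mul_inv] using h2
  -- `F1'` and `F2'` are the two terms of a divergence: the `x`-derivative of `u w_x - w u_x - (m/x)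
  -- u w` and the `y`-derivative of `u w_y - w u_y`. Their sum is `u L_m^* w - w L_m u`.
  set F1' : ℂ → ℂ := fun z => u z * wxx z - w z * iteratedFDeriv ℝ 2 u z ![1, 1]
    - m * ((fderiv ℝ u z 1 * w z + u z * wx z) * (z.re : ℂ)⁻¹
      + u z * w z * (-((z.re : ℂ) ^ 2)⁻¹)) with hF1'
  set F2' : ℂ → ℂ := fun z => u z * wyy z - w z * iteratedFDeriv ℝ 2 u z ![Complex.I, Complex.I]
    with hF2'
  have cF1' : ContinuousOn F1' rightHalfPlane := by
    have : ContinuousOn (fun z : ℂ => ((z.re : ℂ) ^ 2)⁻¹) rightHalfPlane :=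
      (cre.pow 2).inv₀ fun z hz => pow_ne_zero 2 (hne z hz)
    fun_prop
  have cF2' : ContinuousOn F2' rightHalfPlane := by fun_prop
  have z1 : ∀ z ∉ K, F1' z = 0 := fun z hz => by
    obtain ⟨a, b, c, d, e⟩ := h0 z hz
    simp [hF1', a, b, d]
  have z2 : ∀ z ∉ K, F2' z = 0 := fun z hz => by
    obtain ⟨a, b, c, d, e⟩ := h0 z hz
    simp [hF2', a, e]
  have I1 : ∫ z, F1' z = 0 := by
    refine integral_lineDeriv_eq_zero_of_eq_zero_off (U := rightHalfPlane) (K := K) (v := 1)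
      (F := fun z => u z * wx z - w z * fderiv ℝ u z 1 - m * (u z * w z * (z.re : ℂ)⁻¹))
      hU hK hKH (by fun_prop) cF1' ?_ ?_ z1
    · intro z hz
      have a1 := (hud z hz 1).mul' (hwxx z hz)
      have a2 := (hwx z hz).mul' (hasLineDerivAt_fderiv_apply hU hu hz 1)
      have a3 := ((hud z hz 1).mul' (hwx z hz)).mul' (hre z hz)
      have a4 := HasDerivAt.sub (HasDerivAt.sub a1 a2) (HasDerivAt.const_mul m a3)
      refine HasDerivAt.congr_deriv a4 ?_
      simp only [hF1']; ring
    · intro z hz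
      obtain ⟨a, b, c, d, e⟩ := h0 z hz
      simp [a, b]
  have I2 : ∫ z, F2' z = 0 := by
    refine integral_lineDeriv_eq_zero_of_eq_zero_off (U := rightHalfPlane) (K := K)
      (v := Complex.I) (F := fun z => u z * wy z - w z * fderiv ℝ u z Complex.I)
      hU hK hKH (by fun_prop) cF2' ?_ ?_ z2
    · intro z hz
      have a1 := (hud z hz Complex.I).mul' (hwyy z hz)
      have a2 := (hwy z hz).mul' (hasLineDerivAt_fderiv_apply hU hu hz Complex.I)
      refine HasDerivAt.congr_deriv (HasDerivAt.sub a1 a2) ?_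
      simp only [hF2']; ring
    · intro z hz
      obtain ⟨a, b, c, d, e⟩ := h0 z hz
      simp [a, c]
  have hsum := integral_add (cF1'.integrable_of_eq_zero_off hU hK hKH z1)
    (cF2'.integrable_of_eq_zero_off hU hK hKH z2)
  rw [I1, I2, add_zero] at hsum
  rw [← setIntegral_eq_integral_of_forall_compl_eq_zero (s := rightHalfPlane) fun z hz => by
    rw [z1 z fun h => hz (hKH h), z2 z fun h => hz (hKH h), add_zero]] at hsum
  rw [← hsum]
  refine setIntegral_congr_fun hU.measurableSet fun z hz => ?_
  have h := hL z hz
  have hz' := hne z hz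
  simp only [weinsteinOp] at h
  rw [congrFun (InnerProductSpace.laplacian_eq_iteratedFDeriv_complexPlane u) z] at h
  simp only [hF1', hF2']
  linear_combination (w z) * h

/-! ### Derivatives of functions of `x`, `y` and `x² + y²` -/

theorem ofReal_re_ne_zero {z : ℂ} (hz : z ∈ rightHalfPlane) : (z.re : ℂ) ≠ 0 := by
  simpa using (show (0 : ℝ) < z.re from hz).ne'

theorem normSq_pos_of_mem {z : ℂ} (hz : z ∈ rightHalfPlane) : 0 < Complex.normSq z := by
  have h : (0 : ℝ) < z.re := hz
  rw [Complex.normSq_apply]; nlinarith [mul_self_nonneg z.im]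

theorem HasLineDerivAt.add' {f g : ℂ → ℂ} {f' g' z v : ℂ} (hf : HasLineDerivAt ℝ f f' z v)
    (hg : HasLineDerivAt ℝ g g' z v) :
    HasLineDerivAt ℝ (fun y => f y + g y) (f' + g') z v :=
  HasDerivAt.fun_add (𝕜 := ℝ) hf hg

section LineDerivatives

variable {a a' : ℝ → ℂ} {z : ℂ}

theorem hasLineDerivAt_comp_re_one (h : HasDerivAt a (a' z.re) z.re) :
    HasLineDerivAt ℝ (fun z : ℂ => a z.re) (a' z.re) z 1 := by
  have h1 : HasDerivAt (fun t : ℝ => z.re + t) 1 0 := by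
    simpa using (hasDerivAt_id (0 : ℝ)).const_add z.re
  have h2 := HasDerivAt.scomp (0 : ℝ) (g₁ := a) (g₁' := a' z.re) (by simpa using h) h1
  simpa [HasLineDerivAt, Function.comp_def] using h2

theorem hasLineDerivAt_comp_im_I (h : HasDerivAt a (a' z.im) z.im) :
    HasLineDerivAt ℝ (fun z : ℂ => a z.im) (a' z.im) z Complex.I := by
  have h1 : HasDerivAt (fun t : ℝ => z.im + t) 1 0 := by
    simpa using (hasDerivAt_id (0 : ℝ)).const_add z.im
  have h2 := HasDerivAt.scomp (0 : ℝ) (g₁ := a) (g₁' := a' z.im) (by simpa using h) h1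
  simpa [HasLineDerivAt, Function.comp_def] using h2

theorem hasLineDerivAt_comp_re_I : HasLineDerivAt ℝ (fun z : ℂ => a z.re) 0 z Complex.I := by
  simpa [HasLineDerivAt] using hasDerivAt_const (0 : ℝ) (a z.re)

theorem hasLineDerivAt_comp_im_one : HasLineDerivAt ℝ (fun z : ℂ => a z.im) 0 z 1 := by
  simpa [HasLineDerivAt] using hasDerivAt_const (0 : ℝ) (a z.im)

theorem hasLineDerivAt_comp_normSq_one (h : HasDerivAt a (a' (Complex.normSq z)) (Complex.normSq z)) :
    HasLineDerivAt ℝ (fun z : ℂ => a (Complex.normSq z))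
      (2 * z.re * a' (Complex.normSq z)) z 1 := by
  have h1 : HasDerivAt (fun t : ℝ => Complex.normSq (z + (t : ℂ))) (2 * z.re) 0 := by
    have h0 : HasDerivAt (fun t : ℝ => z.re + t) 1 0 := by
      simpa using (hasDerivAt_id (0 : ℝ)).const_add z.re
    have := (h0.fun_mul h0).add_const (z.im * z.im)
    simpa [Complex.normSq_apply, two_mul] using this
  have h2 := HasDerivAt.scomp (0 : ℝ) (g₁ := a) (g₁' := a' (Complex.normSq z)) (by simpa using h) h1
  simpa [HasLineDerivAt, Function.comp_def, Complex.normSq_apply] using h2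

theorem hasLineDerivAt_comp_normSq_I (h : HasDerivAt a (a' (Complex.normSq z)) (Complex.normSq z)) :
    HasLineDerivAt ℝ (fun z : ℂ => a (Complex.normSq z))
      (2 * z.im * a' (Complex.normSq z)) z Complex.I := by
  have h1 : HasDerivAt (fun t : ℝ => Complex.normSq (z + t * Complex.I)) (2 * z.im) 0 := by
    have h0 : HasDerivAt (fun t : ℝ => z.im + t) 1 0 := by
      simpa using (hasDerivAt_id (0 : ℝ)).const_add z.im
    have := (h0.fun_mul h0).const_add (z.re * z.re)
    simpa [Complex.normSq_apply, two_mul] using this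
  have h2 := HasDerivAt.scomp (0 : ℝ) (g₁ := a) (g₁' := a' (Complex.normSq z)) (by simpa using h) h1
  simpa [HasLineDerivAt, Function.comp_def, Complex.normSq_apply] using h2

end LineDerivatives

/-! ### Green's identity for separated test functions -/

theorem isCompact_re_ge_normSq_le (δ C : ℝ) :
    IsCompact {z : ℂ | δ ≤ z.re ∧ Complex.normSq z ≤ C} := by
  refine Metric.isCompact_of_isClosed_isBounded ?_ ?_
  · exact (isClosed_le continuous_const Complex.continuous_re).inter
      (isClosed_le Complex.continuous_normSq continuous_const)
  · refine (Metric.isBounded_closedBall (x := (0 : ℂ)) (r := √C)).subset fun z hz => ?_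
    rw [mem_closedBall_zero_iff]
    exact Real.le_sqrt_of_sq_le (by rw [← Complex.normSq_eq_norm_sq]; exact hz.2)

/-- Green's identity for `w = a(x) p(y) h(x² + y²)`. -/
theorem integral_mul_adjoint_separated_eq_zero {m : ℂ} {u : ℂ → ℂ}
    (hu : ContDiffOn ℝ 2 u rightHalfPlane) (hL : ∀ z ∈ rightHalfPlane, weinsteinOp m u z = 0)
    {a a1 a2 p p1 p2 h h1 h2 : ℝ → ℂ} {δ C : ℝ} (hδ : 0 < δ)
    (ha : ∀ x, 0 < x → HasDerivAt a (a1 x) x) (ha1 : ∀ x, 0 < x → HasDerivAt a1 (a2 x) x)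
    (ha2 : ContinuousOn a2 (Ioi 0)) (ha0 : ∀ x < δ, a x = 0 ∧ a1 x = 0 ∧ a2 x = 0)
    (hp : ∀ y, HasDerivAt p (p1 y) y) (hp1 : ∀ y, HasDerivAt p1 (p2 y) y) (hp2 : Continuous p2)
    (hh : ∀ q, 0 < q → HasDerivAt h (h1 q) q) (hh1 : ∀ q, 0 < q → HasDerivAt h1 (h2 q) q)
    (hh2 : ContinuousOn h2 (Ioi 0)) (hh0 : ∀ q, C < q → h q = 0 ∧ h1 q = 0 ∧ h2 q = 0) :
    ∫ z in rightHalfPlane,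
      u z * ((a2 z.re - m / z.re * a1 z.re + m / (z.re : ℂ) ^ 2 * a z.re) *
            (p z.im * h (Complex.normSq z))
        + (4 * z.re * a1 z.re - 2 * m * a z.re) * (p z.im * h1 (Complex.normSq z))
        + a z.re * (p2 z.im * h (Complex.normSq z)
          + 4 * (p z.im + z.im * p1 z.im) * h1 (Complex.normSq z)
          + 4 * Complex.normSq z * p z.im * h2 (Complex.normSq z))) = 0 := by
  have maps_re : MapsTo Complex.re rightHalfPlane (Ioi 0) := fun z hz => hz
  have maps_q : MapsTo (fun z : ℂ => Complex.normSq z) rightHalfPlane (Ioi 0) :=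
    fun z hz => normSq_pos_of_mem hz
  have c_re : ∀ {b : ℝ → ℂ}, ContinuousOn b (Ioi 0) →
      ContinuousOn (fun z : ℂ => b z.re) rightHalfPlane := fun hb =>
    hb.comp Complex.continuous_re.continuousOn maps_re
  have c_q : ∀ {b : ℝ → ℂ}, ContinuousOn b (Ioi 0) →
      ContinuousOn (fun z : ℂ => b (Complex.normSq z)) rightHalfPlane := fun hb =>
    hb.comp Complex.continuous_normSq.continuousOn maps_q
  have c_im : ∀ {b : ℝ → ℂ}, Continuous b →
      ContinuousOn (fun z : ℂ => b z.im) rightHalfPlane := fun hb =>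
    (hb.comp Complex.continuous_im).continuousOn
  have of_d : ∀ {b b' : ℝ → ℂ}, (∀ x, 0 < x → HasDerivAt b (b' x) x) → ContinuousOn b (Ioi 0) :=
    fun hb x hx => (hb x hx).continuousAt.continuousWithinAt
  have ca := c_re (of_d ha)
  have ca1 := c_re (of_d ha1)
  have ca2 := c_re ha2
  have ch := c_q (of_d hh)
  have ch1 := c_q (of_d hh1)
  have ch2 := c_q hh2
  have cp := c_im (continuous_iff_continuousAt.2 fun y => (hp y).continuousAt)
  have cp1 := c_im (continuous_iff_continuousAt.2 fun y => (hp1 y).continuousAt)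
  have cp2 := c_im hp2
  have cx : ContinuousOn (fun z : ℂ => (z.re : ℂ)) rightHalfPlane :=
    (Complex.continuous_ofReal.comp Complex.continuous_re).continuousOn
  have cy : ContinuousOn (fun z : ℂ => (z.im : ℂ)) rightHalfPlane :=
    (Complex.continuous_ofReal.comp Complex.continuous_im).continuousOn
  have key := integral_mul_adjoint_weinsteinOp_eq_zero hu hL
    (isCompact_re_ge_normSq_le δ C) (fun z hz => show 0 < z.re from hδ.trans_le hz.1)
    (w := fun z => a z.re * p z.im * h (Complex.normSq z))
    (wx := fun z => (a1 z.re * h (Complex.normSq z)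
      + a z.re * (2 * z.re * h1 (Complex.normSq z))) * p z.im)
    (wy := fun z => a z.re * (p1 z.im * h (Complex.normSq z)
      + p z.im * (2 * z.im * h1 (Complex.normSq z))))
    (wxx := fun z => (a2 z.re * h (Complex.normSq z) + 4 * z.re * a1 z.re * h1 (Complex.normSq z)
      + a z.re * (2 * h1 (Complex.normSq z)
        + 4 * (z.re : ℂ) ^ 2 * h2 (Complex.normSq z))) * p z.im)
    (wyy := fun z => a z.re * (p2 z.im * h (Complex.normSq z)
      + 4 * z.im * p1 z.im * h1 (Complex.normSq z)
      + p z.im * (2 * h1 (Complex.normSq z) + 4 * (z.im : ℂ) ^ 2 * h2 (Complex.normSq z))))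
    ?_ ?_ ?_ ?_ ((ca.mul cp).mul ch)
    (((ca1.mul ch).add (ca.mul ((continuousOn_const.mul cx).mul ch1))).mul cp)
    (ca.mul ((cp1.mul ch).add (cp.mul ((continuousOn_const.mul cy).mul ch1))))
    ((((ca2.mul ch).add (((continuousOn_const.mul cx).mul ca1).mul ch1)).add
      (ca.mul ((continuousOn_const.mul ch1).add
        ((continuousOn_const.mul (cx.pow 2)).mul ch2)))).mul cp)
    (ca.mul (((cp2.mul ch).add (((continuousOn_const.mul cy).mul cp1).mul ch1)).add
      (cp.mul ((continuousOn_const.mul ch1).add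
        ((continuousOn_const.mul (cy.pow 2)).mul ch2))))) ?_
  · rw [← key]
    refine setIntegral_congr_fun isOpen_rightHalfPlane.measurableSet fun z hz => ?_
    have hx := ofReal_re_ne_zero hz
    have hq : ((Complex.normSq z : ℝ) : ℂ) = (z.re : ℂ) ^ 2 + (z.im : ℂ) ^ 2 := by
      rw [Complex.normSq_apply]; push_cast; ring
    rw [hq]
    -- The factor `2x` from differentiating `h(x² + y²)` cancels the singular coefficient `m/x`.
    have e1 : m / (z.re : ℂ) * (a z.re * (2 * z.re * h1 (Complex.normSq z)) * p z.im)
        = 2 * m * a z.re * h1 (Complex.normSq z) * p z.im := by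
      field_simp
    linear_combination u z * e1
  · intro z hz
    have d1 := ((hasLineDerivAt_comp_re_one (ha _ hz)).mul'
      (hasLineDerivAt_comp_im_one (a := p))).mul'
      (hasLineDerivAt_comp_normSq_one (hh _ (normSq_pos_of_mem hz)))
    refine HasDerivAt.congr_deriv d1 ?_
    ring
  · intro z hz
    have d1 := ((hasLineDerivAt_comp_re_I (a := a)).mul'
      (hasLineDerivAt_comp_im_I (hp z.im))).mul'
      (hasLineDerivAt_comp_normSq_I (hh _ (normSq_pos_of_mem hz)))
    refine HasDerivAt.congr_deriv d1 ?_
    ring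
  · intro z hz
    have dx : HasLineDerivAt ℝ (fun z : ℂ => (2 * z.re : ℂ)) 2 z 1 :=
      hasLineDerivAt_comp_re_one (a := fun x => (2 * x : ℂ)) (a' := fun _ => 2)
        (by simpa using (hasDerivAt_id z.re).ofReal_comp.const_mul 2)
    have d1 := HasLineDerivAt.mul' (HasLineDerivAt.add'
      ((hasLineDerivAt_comp_re_one (ha1 _ hz)).mul'
        (hasLineDerivAt_comp_normSq_one (hh _ (normSq_pos_of_mem hz))))
      ((hasLineDerivAt_comp_re_one (ha _ hz)).mul'
        (dx.mul' (hasLineDerivAt_comp_normSq_one (hh1 _ (normSq_pos_of_mem hz))))))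
      (hasLineDerivAt_comp_im_one (a := p))
    refine HasDerivAt.congr_deriv d1 ?_
    ring
  · intro z hz
    have dx : HasLineDerivAt ℝ (fun z : ℂ => (2 * z.im : ℂ)) 2 z Complex.I :=
      hasLineDerivAt_comp_im_I (a := fun x => (2 * x : ℂ)) (a' := fun _ => 2)
        (by simpa using (hasDerivAt_id z.im).ofReal_comp.const_mul 2)
    have d1 := (hasLineDerivAt_comp_re_I (a := a)).mul' (HasLineDerivAt.add'
      ((hasLineDerivAt_comp_im_I (hp1 z.im)).mul'
        (hasLineDerivAt_comp_normSq_I (hh _ (normSq_pos_of_mem hz))))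
      ((hasLineDerivAt_comp_im_I (hp z.im)).mul'
        (dx.mul' (hasLineDerivAt_comp_normSq_I (hh1 _ (normSq_pos_of_mem hz))))))
    refine HasDerivAt.congr_deriv d1 ?_
    ring
  · intro z hz
    rcases not_and_or.1 hz with hz | hz
    · obtain ⟨e1, e2, e3⟩ := ha0 _ (not_le.1 hz)
      simp [e1, e2, e3]
    · obtain ⟨e1, e2, e3⟩ := hh0 _ (not_le.1 hz)
      simp [e1, e2, e3]

/-! ### Cutoffs, boundary behaviour and an error estimate -/

/-- A smooth step from `0` (on `s ≤ 1`) to `1` (on `s ≥ 2`) with its first two derivatives. -/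
theorem exists_smooth_step : ∃ (η η1 η2 : ℝ → ℝ) (B : ℝ), 0 < B ∧
    (∀ s, HasDerivAt η (η1 s) s) ∧ (∀ s, HasDerivAt η1 (η2 s) s) ∧ Continuous η2 ∧
    (∀ s < 1, η s = 0 ∧ η1 s = 0 ∧ η2 s = 0) ∧ (∀ s > 2, η s = 1 ∧ η1 s = 0 ∧ η2 s = 0) ∧
    (∀ s, |η s| ≤ 1) ∧ (∀ s, |η1 s| ≤ B) ∧ (∀ s, |η2 s| ≤ B) := by
  set η : ℝ → ℝ := fun s => Real.smoothTransition (s - 1) with hη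
  have hs : ContDiff ℝ 2 η :=
    Real.smoothTransition.contDiff.comp (contDiff_id.sub contDiff_const)
  have hs1 : ContDiff ℝ 1 (deriv η) := ((contDiff_succ_iff_deriv (n := 1)).1 hs).2.2
  have hs2 : Continuous (deriv (deriv η)) := hs1.continuous_deriv (by norm_num)
  have lo : ∀ s < 1, η =ᶠ[𝓝 s] fun _ => 0 := fun s hs => by
    filter_upwards [Iio_mem_nhds hs] with t ht
    exact Real.smoothTransition.zero_of_nonpos (by linarith [show t < 1 from ht])
  have hi : ∀ s > 2, η =ᶠ[𝓝 s] fun _ => 1 := fun s hs => by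
    filter_upwards [Ioi_mem_nhds hs] with t ht
    exact Real.smoothTransition.one_of_one_le (by linarith [show 2 < t from ht])
  have lo' : ∀ s < 1, deriv η s = 0 ∧ deriv (deriv η) s = 0 := fun s hs => by
    have h1 := (lo s hs).deriv
    have h2 := h1.deriv
    exact ⟨by simpa using h1.eq_of_nhds, by simpa using h2.eq_of_nhds⟩
  have hi' : ∀ s > 2, deriv η s = 0 ∧ deriv (deriv η) s = 0 := fun s hs => by
    have h1 := (hi s hs).deriv
    have h2 := h1.deriv
    exact ⟨by simpa using h1.eq_of_nhds, by simpa using h2.eq_of_nhds⟩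
  -- Both derivatives vanish off `[1, 2]`, so bounds on this compact interval are global.
  obtain ⟨B1, hB1⟩ := (isCompact_Icc (a := (1 : ℝ)) (b := 2)).exists_bound_of_continuousOn
    hs1.continuous.continuousOn
  obtain ⟨B2, hB2⟩ := (isCompact_Icc (a := (1 : ℝ)) (b := 2)).exists_bound_of_continuousOn
    hs2.continuousOn
  refine ⟨η, deriv η, deriv (deriv η), max 1 (max B1 B2), by positivity,
    fun s => (hs.differentiable (by norm_num) s).hasDerivAt,
    fun s => (hs1.differentiable (by norm_num) s).hasDerivAt, hs2,
    fun s h => ⟨(lo s h).eq_of_nhds, lo' s h⟩, fun s h => ⟨(hi s h).eq_of_nhds, hi' s h⟩,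
    fun s => ?_, fun s => ?_, fun s => ?_⟩
  · rw [abs_of_nonneg (Real.smoothTransition.nonneg _)]
    exact Real.smoothTransition.le_one _
  · rcases lt_or_ge s 1 with h | h
    · simp [(lo' s h).1]
    rcases lt_or_ge 2 s with h2 | h2
    · simp [(hi' s h2).1]
    · exact (hB1 s ⟨h, h2⟩).trans (by simp)
  · rcases lt_or_ge s 1 with h | h
    · simp [(lo' s h).2]
    rcases lt_or_ge 2 s with h2 | h2
    · simp [(hi' s h2).2]
    · exact (hB2 s ⟨h, h2⟩).trans (by simp)

section BoundaryBehaviour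

variable {u : ℂ → ℂ}

theorem TendsToZeroAtBoundary.norm_le_of_re_le (hlim : TendsToZeroAtBoundary u) {ε : ℝ}
    (hε : 0 < ε) : ∃ δ > 0, ∀ z ∈ rightHalfPlane, z.re ≤ δ → ‖u z‖ ≤ ε := by
  obtain ⟨N, hN, h⟩ := hlim ε hε
  exact ⟨1 / N, by positivity, fun z hz hx => h N le_rfl z hz (Or.inl hx)⟩

theorem TendsToZeroAtBoundary.norm_le_of_le_norm (hlim : TendsToZeroAtBoundary u) {ε : ℝ}
    (hε : 0 < ε) : ∃ R > 0, ∀ z ∈ rightHalfPlane, R ≤ ‖z‖ → ‖u z‖ ≤ ε := by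
  obtain ⟨N, hN, h⟩ := hlim ε hε
  exact ⟨N, by positivity, fun z hz hx => h N le_rfl z hz (Or.inr hx)⟩

theorem TendsToZeroAtBoundary.bounded (hlim : TendsToZeroAtBoundary u)
    (hu : ContinuousOn u rightHalfPlane) : ∃ M > 0, ∀ z ∈ rightHalfPlane, ‖u z‖ ≤ M := by
  obtain ⟨δ, hδ, h1⟩ := hlim.norm_le_of_re_le one_pos
  obtain ⟨R, hR, h2⟩ := hlim.norm_le_of_le_norm one_pos
  obtain ⟨M, hM⟩ := (isCompact_re_ge_normSq_le δ (R ^ 2)).exists_bound_of_continuousOn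
    (hu.mono fun z hz => show 0 < z.re from hδ.trans_le hz.1)
  refine ⟨max 1 M, by positivity, fun z hz => ?_⟩
  rcases le_total z.re δ with h | h
  · exact (h1 z hz h).trans (le_max_left _ _)
  rcases le_total R ‖z‖ with h' | h'
  · exact (h2 z hz h').trans (le_max_left _ _)
  · refine (hM z ⟨h, ?_⟩).trans (le_max_right _ _)
    rw [Complex.normSq_eq_norm_sq]
    gcongr

end BoundaryBehaviour

/-- Serves the cutoff errors: they live on a set of small or controlled volume, and supremum times
volume is all that is needed. -/
theorem integrableOn_and_norm_integral_le {f : ℂ → ℂ} {S : Set ℂ} {D : ℝ}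
    (hf : ContinuousOn f rightHalfPlane) (hS : MeasurableSet S) (hv : volume S < ⊤) (hD0 : 0 ≤ D)
    (hD : ∀ z ∈ rightHalfPlane, z ∈ S → ‖f z‖ ≤ D) (h0 : ∀ z ∈ rightHalfPlane, z ∉ S → f z = 0) :
    IntegrableOn f rightHalfPlane ∧ ‖∫ z in rightHalfPlane, f z‖ ≤ D * volume.real S := by
  have hH := isOpen_rightHalfPlane.measurableSet
  have hv' : volume (rightHalfPlane ∩ S) < ⊤ := (measure_mono inter_subset_right).trans_lt hv
  have e : ∫ z in rightHalfPlane, f z = ∫ z in rightHalfPlane ∩ S, f z :=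
    (setIntegral_eq_of_subset_of_forall_sdiff_eq_zero hH inter_subset_left fun z hz =>
      h0 z hz.1 fun h => hz.2 ⟨hz.1, h⟩)
  have hi : IntegrableOn f (rightHalfPlane ∩ S) :=
    IntegrableOn.of_bound hv' ((hf.mono inter_subset_left).aestronglyMeasurable (hH.inter hS)) D
      ((ae_restrict_iff' (hH.inter hS)).2 (Eventually.of_forall fun z hz => hD z hz.1 hz.2))
  refine ⟨?_, ?_⟩
  · exact hi.of_forall_sdiff_eq_zero hH fun z hz => h0 z hz.1 fun h => hz.2 ⟨hz.1, h⟩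
  · rw [e]
    refine (norm_setIntegral_le_of_norm_le_const hv' fun z hz => hD z hz.1 hz.2).trans ?_
    exact mul_le_mul_of_nonneg_left (measureReal_mono inter_subset_right hv.ne) hD0

theorem volume_reProdIm_Icc {a b c d : ℝ} :
    volume (Icc a b ×ℂ Icc c d) = ENNReal.ofReal (b - a) * ENNReal.ofReal (d - c) := by
  have : Icc a b ×ℂ Icc c d = Complex.measurableEquivRealProd ⁻¹' (Icc a b ×ˢ Icc c d) := rfl
  rw [this, Complex.volume_preserving_equiv_real_prod.measure_preimage
    (measurableSet_Icc.prod measurableSet_Icc).nullMeasurableSet, Measure.volume_eq_prod,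
    Measure.prod_prod, Real.volume_Icc, Real.volume_Icc]

/-! ### Removing the cutoff at the `y`-axis -/

theorem hasDerivAt_ofReal_cpow {κ : ℂ} (hκ : κ ≠ 0) {x : ℝ} (hx : 0 < x) :
    HasDerivAt (fun x : ℝ => (x : ℂ) ^ κ) ((x : ℂ) ^ κ * (κ / x)) x := by
  have hx' : (x : ℂ) ≠ 0 := by simpa using hx.ne'
  refine (hasDerivAt_ofReal_cpow_const hx.ne' hκ).congr_deriv ?_
  rw [Complex.cpow_sub _ _ hx', Complex.cpow_one]
  ring

theorem continuousOn_ofReal_re_cpow (κ : ℂ) :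
    ContinuousOn (fun z : ℂ => (z.re : ℂ) ^ κ) rightHalfPlane := fun z hz =>
  ContinuousAt.continuousWithinAt <| ContinuousAt.comp (f := fun z : ℂ => (z.re : ℂ))
    (continuousAt_cpow_const (Or.inl (show 0 < z.re from hz)))
    (Complex.continuous_ofReal.comp Complex.continuous_re).continuousAt

set_option maxHeartbeats 1000000 in
/-- If `x ^ κ` solves the adjoint equation and `Re κ ≥ 1`, the adjoint identity holds for
`w = x ^ κ p(y) h(x² + y²)`, without a cutoff near the `y`-axis. -/
theorem integral_mul_cpow_mul_eq_zero {m κ k : ℂ} (hκ : (κ - 1) * (κ - m) = 0)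
    (hk : k = 2 * κ - m) (hre : 1 ≤ κ.re) {u : ℂ → ℂ}
    (hu : ContDiffOn ℝ 2 u rightHalfPlane) (hL : ∀ z ∈ rightHalfPlane, weinsteinOp m u z = 0)
    (hlim : TendsToZeroAtBoundary u)
    {p p1 p2 h h1 h2 : ℝ → ℂ} {B C : ℝ} (hC : 0 < C)
    (hp : ∀ y, HasDerivAt p (p1 y) y) (hp1 : ∀ y, HasDerivAt p1 (p2 y) y) (hp2 : Continuous p2)
    (hh : ∀ q, 0 < q → HasDerivAt h (h1 q) q) (hh1 : ∀ q, 0 < q → HasDerivAt h1 (h2 q) q)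
    (hh2 : ContinuousOn h2 (Ioi 0)) (hh0 : ∀ q, C < q → h q = 0 ∧ h1 q = 0 ∧ h2 q = 0)
    (hB : ∀ q, 0 < q → ‖h q‖ ≤ B ∧ ‖h1 q‖ ≤ B ∧ ‖h2 q‖ ≤ B) :
    ∫ z in rightHalfPlane, u z * (z.re : ℂ) ^ κ * (p2 z.im * h (Complex.normSq z)
      + (4 * (p z.im + z.im * p1 z.im) + 2 * k * p z.im) * h1 (Complex.normSq z)
      + 4 * Complex.normSq z * p z.im * h2 (Complex.normSq z)) = 0 := by
  have hκ0 : κ ≠ 0 := fun h => by rw [h] at hre; norm_num at hre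
  have hH := isOpen_rightHalfPlane.measurableSet
  obtain ⟨η, η1, η2, B', hB', dη, dη1, cη2, ηlo, ηhi, bη, bη1, bη2⟩ := exists_smooth_step
  obtain ⟨M, hM0, hM⟩ := hlim.bounded hu.continuousOn
  have hB0 : 0 ≤ B := (norm_nonneg _).trans (hB 1 one_pos).1
  have cpp : Continuous p := continuous_iff_continuousAt.2 fun y => (hp y).continuousAt
  have cpp1 : Continuous p1 := continuous_iff_continuousAt.2 fun y => (hp1 y).continuousAt
  have cη : Continuous η := continuous_iff_continuousAt.2 fun y => (dη y).continuousAt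
  have cη1 : Continuous η1 := continuous_iff_continuousAt.2 fun y => (dη1 y).continuousAt
  have bound_p : ∀ {r : ℝ → ℂ}, Continuous r → ∃ P, 0 ≤ P ∧ ∀ y ∈ Icc (-√C) √C, ‖r y‖ ≤ P := by
    intro r hr
    obtain ⟨P, hP⟩ := (isCompact_Icc (a := -√C) (b := √C)).exists_bound_of_continuousOn
      hr.continuousOn
    exact ⟨max 0 P, le_max_left _ _, fun y hy => (hP y hy).trans (le_max_right _ _)⟩
  obtain ⟨P, hP0, hP⟩ := bound_p cpp
  obtain ⟨P1, hP10, hP1⟩ := bound_p cpp1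
  obtain ⟨P2, hP20, hP2⟩ := bound_p hp2
  -- continuity on the half-plane
  have cu := hu.continuousOn
  have cX := continuousOn_ofReal_re_cpow κ
  have c_q : ∀ {b : ℝ → ℂ}, ContinuousOn b (Ioi 0) →
      ContinuousOn (fun z : ℂ => b (Complex.normSq z)) rightHalfPlane := fun hb =>
    hb.comp Complex.continuous_normSq.continuousOn fun z hz => normSq_pos_of_mem hz
  have c_im : ∀ {b : ℝ → ℂ}, Continuous b →
      ContinuousOn (fun z : ℂ => b z.im) rightHalfPlane := fun hb =>
    (hb.comp Complex.continuous_im).continuousOn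
  have of_d : ∀ {b b' : ℝ → ℂ}, (∀ x, 0 < x → HasDerivAt b (b' x) x) → ContinuousOn b (Ioi 0) :=
    fun hb x hx => (hb x hx).continuousAt.continuousWithinAt
  have ch := c_q (of_d hh)
  have ch1 := c_q (of_d hh1)
  have ch2 := c_q hh2
  have cp := c_im cpp
  have cp1 := c_im cpp1
  have cp2 := c_im hp2
  have cx : ContinuousOn (fun z : ℂ => (z.re : ℂ)) rightHalfPlane :=
    (Complex.continuous_ofReal.comp Complex.continuous_re).continuousOn
  have cy : ContinuousOn (fun z : ℂ => (z.im : ℂ)) rightHalfPlane :=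
    (Complex.continuous_ofReal.comp Complex.continuous_im).continuousOn
  have cn : ContinuousOn (fun z : ℂ => ((Complex.normSq z : ℝ) : ℂ)) rightHalfPlane :=
    (Complex.continuous_ofReal.comp Complex.continuous_normSq).continuousOn
  -- geometry
  have geom : ∀ z : ℂ, Complex.normSq z ≤ C → z.im ∈ Icc (-√C) √C ∧ z.re ≤ √C := by
    intro z hz
    rw [Complex.normSq_apply] at hz
    refine ⟨abs_le.1 (Real.abs_le_sqrt (by nlinarith [mul_self_nonneg z.re])), ?_⟩
    exact (le_abs_self _).trans (Real.abs_le_sqrt (by nlinarith [mul_self_nonneg z.im]))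
  have nX : ∀ z ∈ rightHalfPlane, ‖(z.re : ℂ) ^ κ‖ = z.re ^ κ.re := fun z hz =>
    Complex.norm_cpow_eq_rpow_re_of_pos hz κ
  set f : ℂ → ℂ := fun z => u z * (z.re : ℂ) ^ κ * (p2 z.im * h (Complex.normSq z)
      + (4 * (p z.im + z.im * p1 z.im) + 2 * k * p z.im) * h1 (Complex.normSq z)
      + 4 * Complex.normSq z * p z.im * h2 (Complex.normSq z)) with hf
  have cf : ContinuousOn f rightHalfPlane :=
    (cu.mul cX).mul (((cp2.mul ch).add (((continuousOn_const.mul (cp.add (cy.mul cp1))).add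
      (continuousOn_const.mul cp)).mul ch1)).add (((continuousOn_const.mul cn).mul cp).mul ch2))
  have fi : IntegrableOn f rightHalfPlane := by
    have hvol : volume {z : ℂ | Complex.normSq z ≤ C} < ⊤ := by
      have : {z : ℂ | Complex.normSq z ≤ C} = Metric.closedBall 0 √C := by
        ext z
        rw [mem_ofPred_eq, mem_closedBall_zero_iff, Real.le_sqrt (norm_nonneg _) hC.le,
          Complex.normSq_eq_norm_sq]
      rw [this]; exact measure_closedBall_lt_top
    refine (integrableOn_and_norm_integral_le (S := {z : ℂ | Complex.normSq z ≤ C})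
      (D := M * √C ^ κ.re * (P2 * B + (4 * (P + √C * P1) + 2 * ‖k‖ * P) * B + 4 * C * P * B)) cf
      (isClosed_le Complex.continuous_normSq continuous_const).measurableSet hvol
      (by positivity) ?_ ?_).1
    · intro z hz hzC
      obtain ⟨hy, hx⟩ := geom z hzC
      obtain ⟨b, b1, b2⟩ := hB _ (normSq_pos_of_mem hz)
      have hx0 : 0 < z.re := hz
      have hXle : ‖(z.re : ℂ) ^ κ‖ ≤ √C ^ κ.re := by
        rw [nX z hz]; exact Real.rpow_le_rpow hx0.le hx (by linarith)
      have hyn : ‖(z.im : ℂ)‖ ≤ √C := by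
        rw [Complex.norm_real, Real.norm_eq_abs]; exact abs_le.2 hy
      have hqn : ‖((Complex.normSq z : ℝ) : ℂ)‖ ≤ C := by
        rw [Complex.norm_real, Real.norm_eq_abs, abs_of_nonneg (Complex.normSq_nonneg z)]
        exact hzC
      rw [hf]
      simp only [norm_mul]
      refine mul_le_mul (mul_le_mul (hM z hz) hXle (norm_nonneg _) hM0.le) ?_ (norm_nonneg _)
        (by positivity)
      refine (norm_add₃_le).trans ?_
      simp only [norm_mul]
      have e1 : ‖4 * (p z.im + z.im * p1 z.im) + 2 * k * p z.im‖
          ≤ 4 * (P + √C * P1) + 2 * ‖k‖ * P := by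
        refine (norm_add_le _ _).trans ?_
        simp only [norm_mul]
        have : ‖p z.im + z.im * p1 z.im‖ ≤ P + √C * P1 := by
          refine (norm_add_le _ _).trans ?_
          rw [norm_mul]
          gcongr
          exacts [hP _ hy, hP1 _ hy]
        have h4 : ‖(4 : ℂ)‖ = 4 := by norm_num
        have h2 : ‖(2 : ℂ)‖ = 2 := by norm_num
        rw [h4, h2]
        gcongr
        exact hP _ hy
      have h4 : ‖(4 : ℂ)‖ = 4 := by norm_num
      rw [h4]
      gcongr
      exacts [hP2 _ hy, hP _ hy]
    · intro z hz hzC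
      obtain ⟨e1, e2, e3⟩ := hh0 _ (not_le.1 hzC)
      simp [hf, e1, e2, e3]
  -- the identity with a cutoff
  set E : ℝ → ℂ → ℂ := fun δ z => u z * ((z.re : ℂ) ^ κ * (p z.im * h (Complex.normSq z) *
      (k / (z.re * δ) * η1 (z.re / δ) + η2 (z.re / δ) / δ ^ 2)
      + 4 * (z.re * (η1 (z.re / δ) / δ)) * (p z.im * h1 (Complex.normSq z)))) with hE
  -- Green's identity for `a(x) = x^κ η(x/δ)`. The terms with `η` undifferentiated give `f η`; those
  -- with `η'` or `η''` form `E δ`.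
  have ident : ∀ δ > 0, ∫ z in rightHalfPlane, (f z * η (z.re / δ) + E δ z) = 0 := by
    intro δ hδ
    have hδ' : (δ : ℂ) ≠ 0 := by simpa using hδ.ne'
    have dsc : ∀ {b b' : ℝ → ℝ}, (∀ s, HasDerivAt b (b' s) s) → ∀ x : ℝ,
        HasDerivAt (fun x : ℝ => ((b (x / δ) : ℝ) : ℂ)) ((b' (x / δ) : ℝ) / δ : ℂ) x := by
      intro b b' hb x
      have h1 : HasDerivAt (fun x : ℝ => x / δ) (1 / δ) x := (hasDerivAt_id x).div_const δ
      have h2 := ((hb (x / δ)).comp x h1).ofReal_comp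
      refine h2.congr_deriv ?_
      push_cast; ring
    have dinv : ∀ x : ℝ, 0 < x → HasDerivAt (fun x : ℝ => κ / (x : ℂ)) (-κ / (x : ℂ) ^ 2) x := by
      intro x hx
      have hx' : (x : ℂ) ≠ 0 := by simpa using hx.ne'
      have h1 : HasDerivAt (fun x : ℝ => (x : ℂ)) 1 x := by
        simpa using (hasDerivAt_id x).ofReal_comp
      have h2 := (h1.fun_inv hx').const_mul κ
      simpa [div_eq_mul_inv] using h2
    have key := integral_mul_adjoint_separated_eq_zero hu hL (δ := δ) (C := C) hδ
      (a := fun x => (x : ℂ) ^ κ * (η (x / δ) : ℝ))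
      (a1 := fun x => (x : ℂ) ^ κ * (κ / x * (η (x / δ) : ℝ) + (η1 (x / δ) : ℝ) / δ))
      (a2 := fun x => (x : ℂ) ^ κ * (κ * (κ - 1) / (x : ℂ) ^ 2 * (η (x / δ) : ℝ)
        + 2 * κ / (x * δ) * (η1 (x / δ) : ℝ) + (η2 (x / δ) : ℝ) / (δ : ℂ) ^ 2))
      ?_ ?_ ?_ ?_ hp hp1 hp2 hh hh1 hh2 hh0
    · rw [← key]
      refine setIntegral_congr_fun hH fun z hz => ?_
      have hx := ofReal_re_ne_zero hz
      simp only [hf, hE, hk]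
      -- The indicial equation: `x^κ` solves `a'' - (m/x) a' + (m/x²) a = 0`, which removes the `η /
      -- x²` terms.
      have hκ' : κ * (κ - 1) - m * κ + m = 0 := by linear_combination hκ
      have e1 : ((z.re : ℂ) ^ κ * (κ * (κ - 1) / (z.re : ℂ) ^ 2 * (η (z.re / δ) : ℝ)
          + 2 * κ / (z.re * δ) * (η1 (z.re / δ) : ℝ) + (η2 (z.re / δ) : ℝ) / (δ : ℂ) ^ 2)
          - m / z.re * ((z.re : ℂ) ^ κ * (κ / z.re * (η (z.re / δ) : ℝ)
            + (η1 (z.re / δ) : ℝ) / δ))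
          + m / (z.re : ℂ) ^ 2 * ((z.re : ℂ) ^ κ * (η (z.re / δ) : ℝ)))
          = (z.re : ℂ) ^ κ * ((2 * κ - m) / (z.re * δ) * (η1 (z.re / δ) : ℝ)
            + (η2 (z.re / δ) : ℝ) / (δ : ℂ) ^ 2) := by
        field_simp
        linear_combination (z.re : ℂ) ^ κ * (δ : ℂ) ^ 2 * (η (z.re / δ) : ℂ) * hκ'
      have e2 : 4 * (z.re : ℂ) * ((z.re : ℂ) ^ κ * (κ / z.re * (η (z.re / δ) : ℝ)
          + (η1 (z.re / δ) : ℝ) / δ)) = (z.re : ℂ) ^ κ * (4 * κ * (η (z.re / δ) : ℝ)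
          + 4 * (z.re * ((η1 (z.re / δ) : ℝ) / δ))) := by
        field_simp
      rw [e1, e2]
      ring
    · intro x hx
      refine ((hasDerivAt_ofReal_cpow hκ0 hx).fun_mul (dsc dη x)).congr_deriv ?_
      ring
    · intro x hx
      have hx' : (x : ℂ) ≠ 0 := by simpa using hx.ne'
      refine ((hasDerivAt_ofReal_cpow hκ0 hx).fun_mul
        (((dinv x hx).fun_mul (dsc dη x)).fun_add ((dsc dη1 x).div_const (δ : ℂ)))).congr_deriv ?_
      field_simp
      ring
    · have cc : ∀ {b : ℝ → ℝ}, Continuous b →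
          ContinuousOn (fun x : ℝ => ((b (x / δ) : ℝ) : ℂ)) (Ioi 0) := fun hb =>
        (Complex.continuous_ofReal.comp (hb.comp (continuous_id.div_const δ))).continuousOn
      have cxx : ContinuousOn (fun x : ℝ => (x : ℂ)) (Ioi 0) :=
        Complex.continuous_ofReal.continuousOn
      have hne : ∀ x ∈ Ioi (0 : ℝ), (x : ℂ) ≠ 0 := fun x hx => by
        simpa using (show 0 < x from hx).ne'
      have cpow : ContinuousOn (fun x : ℝ => (x : ℂ) ^ κ) (Ioi 0) := fun x hx =>
        (hasDerivAt_ofReal_cpow hκ0 hx).continuousAt.continuousWithinAt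
      exact cpow.mul ((((continuousOn_const.div (cxx.pow 2) fun x hx =>
        pow_ne_zero 2 (hne x hx)).mul (cc cη)).add ((continuousOn_const.div
        (cxx.mul continuousOn_const) fun x hx => mul_ne_zero (hne x hx) hδ').mul (cc cη1))).add
        ((cc cη2).div_const _))
    · intro x hx
      obtain ⟨e1, e2, e3⟩ := ηlo (x / δ) ((div_lt_one hδ).2 hx)
      simp [e1, e2, e3]
  have cE : ∀ δ > 0, ContinuousOn (E δ) rightHalfPlane := by
    intro δ hδ
    have hδ' : (δ : ℂ) ≠ 0 := by simpa using hδ.ne'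
    have cc : ∀ {b : ℝ → ℝ}, Continuous b →
        ContinuousOn (fun z : ℂ => ((b (z.re / δ) : ℝ) : ℂ)) rightHalfPlane := fun hb =>
      (Complex.continuous_ofReal.comp
        (hb.comp (Complex.continuous_re.div_const δ))).continuousOn
    exact cu.mul (cX.mul (((cp.mul ch).mul (((continuousOn_const.div (cx.mul continuousOn_const)
      fun z hz => mul_ne_zero (ofReal_re_ne_zero hz) hδ').mul (cc cη1)).add
      ((cc cη2).div_const _))).add ((continuousOn_const.mul (cx.mul ((cc cη1).div_const _))).mul
      (cp.mul ch1))))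
  -- the error term
  set D : ℝ := 2 ^ κ.re * (P * B * (‖k‖ * B' + B') + 8 * B' * (P * B)) with hD
  have hD0 : 0 ≤ D := by positivity
  -- `E δ` is supported in `δ ≤ x ≤ 2δ`, where `|u| ≤ ε` and `|x^κ|` is `O(δ)` because `Re κ ≥ 1`
  -- and `δ ≤ 1`. Two derivatives of the cutoff cost `δ⁻²`, so `E δ = O(ε/δ)` on a rectangle of area
  -- `2δ√C`.
  have err : ∀ ε > 0, ∃ δ0 > 0, ∀ δ, 0 < δ → δ ≤ δ0 → IntegrableOn (E δ) rightHalfPlane ∧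
      ‖∫ z in rightHalfPlane, E δ z‖ ≤ ε * D * (2 * √C) := by
    intro ε hε
    obtain ⟨δ0, hδ0, hs⟩ := hlim.norm_le_of_re_le hε
    refine ⟨min 1 (δ0 / 2), by positivity, fun δ hδ hle => ?_⟩
    have hle1 : δ ≤ 1 := hle.trans (min_le_left _ _)
    have hle2 : 2 * δ ≤ δ0 := by linarith [hle.trans (min_le_right _ _)]
    have hvol : volume (Icc δ (2 * δ) ×ℂ Icc (-√C) √C)
        = ENNReal.ofReal (2 * δ - δ) * ENNReal.ofReal (√C - -√C) := volume_reProdIm_Icc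
    have hvr : volume.real (Icc δ (2 * δ) ×ℂ Icc (-√C) √C) = δ * (2 * √C) := by
      rw [measureReal_def, hvol, ENNReal.toReal_mul, ENNReal.toReal_ofReal (by linarith),
        ENNReal.toReal_ofReal (by linarith [Real.sqrt_nonneg C])]
      ring
    have := integrableOn_and_norm_integral_le (S := Icc δ (2 * δ) ×ℂ Icc (-√C) √C)
      (D := ε * (D / δ)) (cE δ hδ) (isClosed_Icc.reProdIm isClosed_Icc).measurableSet
      (by rw [hvol]; exact ENNReal.mul_lt_top ENNReal.ofReal_lt_top ENNReal.ofReal_lt_top)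
      (by positivity) ?_ ?_
    · refine ⟨this.1, this.2.trans (le_of_eq ?_)⟩
      rw [hvr]; field_simp
    · intro z hz hzS
      obtain ⟨hxS, hyS⟩ := Complex.mem_reProdIm.1 hzS
      obtain ⟨b, b1, b2⟩ := hB _ (normSq_pos_of_mem hz)
      have hx0 : 0 < z.re := hz
      have hX : ‖(z.re : ℂ) ^ κ‖ ≤ 2 ^ κ.re * δ := by
        rw [nX z hz]
        have : (2 * δ) ^ κ.re = 2 ^ κ.re * δ ^ κ.re := Real.mul_rpow (by norm_num) hδ.le
        calc z.re ^ κ.re ≤ (2 * δ) ^ κ.re := Real.rpow_le_rpow hx0.le hxS.2 (by linarith)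
          _ = 2 ^ κ.re * δ ^ κ.re := this
          _ ≤ 2 ^ κ.re * δ := by
            gcongr
            exact Real.rpow_le_self_of_le_one hδ.le hle1 hre
      rw [hE]
      simp only [norm_mul]
      refine mul_le_mul (hs z hz (hxS.2.trans hle2)) ?_ (by positivity) hε.le
      have nδ : ‖(δ : ℂ)‖ = δ := by simp [abs_of_pos hδ]
      have nx : ‖(z.re : ℂ)‖ = z.re := by simp [abs_of_pos hx0]
      have n1 : ‖((η1 (z.re / δ) : ℝ) : ℂ)‖ ≤ B' := by simpa using bη1 _
      have n2 : ‖((η2 (z.re / δ) : ℝ) : ℂ)‖ ≤ B' := by simpa using bη2 _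
      have h4 : ‖(4 : ℂ)‖ = 4 := by norm_num
      have q1 : ‖k / (z.re * δ) * (η1 (z.re / δ) : ℝ) + (η2 (z.re / δ) : ℝ) / (δ : ℂ) ^ 2‖
          ≤ (‖k‖ * B' + B') / δ ^ 2 := by
        refine (norm_add_le _ _).trans ?_
        simp only [norm_mul, norm_div, norm_pow, nδ, nx]
        rw [add_div, mul_comm ‖k‖ B', mul_div_assoc, mul_comm (‖k‖ / _)]
        gcongr
        nlinarith [hxS.1]
      -- This term is bounded; the weaker bound by `δ⁻²`, valid since `δ ≤ 1`, puts it on the same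
      -- footing as `q1`.
      have q2 : ‖4 * ((z.re : ℂ) * ((η1 (z.re / δ) : ℝ) / (δ : ℂ)))‖ ≤ 8 * B' / δ ^ 2 := by
        simp only [norm_mul, norm_div, nδ, nx, h4]
        calc 4 * (z.re * (‖((η1 (z.re / δ) : ℝ) : ℂ)‖ / δ)) ≤ 4 * (2 * δ * (B' / δ)) := by
              gcongr; exact hxS.2
          _ = 8 * B' / 1 := by field_simp; ring
          _ ≤ 8 * B' / δ ^ 2 := by
            gcongr
            nlinarith
      have q3 : ‖p z.im * h (Complex.normSq z) *
          (k / (z.re * δ) * (η1 (z.re / δ) : ℝ) + (η2 (z.re / δ) : ℝ) / (δ : ℂ) ^ 2)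
          + 4 * (z.re * ((η1 (z.re / δ) : ℝ) / δ)) * (p z.im * h1 (Complex.normSq z))‖
          ≤ (P * B * (‖k‖ * B' + B') + 8 * B' * (P * B)) / δ ^ 2 := by
        refine (norm_add_le _ _).trans ?_
        rw [norm_mul, norm_mul (p z.im), norm_mul _ (p z.im * _), norm_mul (p z.im)]
        calc _ ≤ P * B * ((‖k‖ * B' + B') / δ ^ 2) + 8 * B' / δ ^ 2 * (P * B) := by
              gcongr
              exacts [hP _ hyS, hP _ hyS]
          _ = _ := by ring
      calc _ ≤ 2 ^ κ.re * δ * ((P * B * (‖k‖ * B' + B') + 8 * B' * (P * B)) / δ ^ 2) := by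
            gcongr
        _ = D / δ := by rw [hD]; field_simp
    · intro z hz hzS
      have hx0 : 0 < z.re := hz
      by_cases hq : Complex.normSq z ≤ C
      · have hy := (geom z hq).1
        have hx : z.re < δ ∨ 2 * δ < z.re := by
          by_contra hcon
          push Not at hcon
          exact hzS (Complex.mem_reProdIm.2 ⟨hcon, hy⟩)
        have : η1 (z.re / δ) = 0 ∧ η2 (z.re / δ) = 0 := by
          rcases hx with hx | hx
          · exact (ηlo _ ((div_lt_one hδ).2 hx)).2
          · exact (ηhi _ ((lt_div_iff₀ hδ).2 hx)).2
        simp [hE, this.1, this.2]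
      · obtain ⟨e1, e2, e3⟩ := hh0 _ (not_le.1 hq)
        simp [hE, e1, e2]
  -- passage to the limit
  have lim1 : Tendsto (fun δ : ℝ => ∫ z in rightHalfPlane, f z * η (z.re / δ)) (𝓝[>] 0)
      (𝓝 (∫ z in rightHalfPlane, f z)) := by
    refine tendsto_integral_filter_of_dominated_convergence (fun z => ‖f z‖) ?_ ?_ fi.norm ?_
    · filter_upwards with δ
      exact (cf.mul (Complex.continuous_ofReal.comp
        (cη.comp (Complex.continuous_re.div_const δ))).continuousOn).aestronglyMeasurable hH
    · filter_upwards with δ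
      filter_upwards with z
      rw [norm_mul]
      refine mul_le_of_le_one_right (norm_nonneg _) ?_
      simpa using bη (z.re / δ)
    · refine (ae_restrict_iff' hH).2 (Eventually.of_forall fun z hz => ?_)
      have hx0 : 0 < z.re := hz
      refine tendsto_const_nhds.congr' ?_
      filter_upwards [Ioo_mem_nhdsGT (show 0 < z.re / 3 by positivity)] with δ hδ
      rw [(ηhi (z.re / δ) ((lt_div_iff₀ hδ.1).2 (by linarith [hδ.2]))).1]
      simp
  have lim2 : Tendsto (fun δ : ℝ => ∫ z in rightHalfPlane, f z * η (z.re / δ)) (𝓝[>] 0)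
      (𝓝 0) := by
    rw [Metric.tendsto_nhds]
    intro ε hε
    obtain ⟨δ0, hδ0, hs⟩ := err (ε / (2 * (D * (2 * √C) + 1))) (by positivity)
    filter_upwards [Ioc_mem_nhdsGT hδ0] with δ hδ
    obtain ⟨i1, i2⟩ := hs δ hδ.1 hδ.2
    have fη : IntegrableOn (fun z => f z * η (z.re / δ)) rightHalfPlane := by
      refine Integrable.mono fi ((cf.mul (Complex.continuous_ofReal.comp
        (cη.comp (Complex.continuous_re.div_const δ))).continuousOn).aestronglyMeasurable hH) ?_
      filter_upwards with z
      rw [norm_mul]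
      refine mul_le_of_le_one_right (norm_nonneg _) ?_
      simpa using bη (z.re / δ)
    have h3 := ident δ hδ.1
    rw [integral_add fη i1] at h3
    rw [dist_zero_right, eq_neg_of_add_eq_zero_left h3, norm_neg]
    refine i2.trans_lt ?_
    have hK : 0 ≤ D * (2 * √C) := by positivity
    rw [mul_assoc, div_mul_eq_mul_div, div_lt_iff₀ (by positivity)]
    nlinarith
  exact tendsto_nhds_unique lim1 lim2

/-! ### Moments: size and integrability -/

/-- The density `u x^κ y^j (1 + x² + y²)^(-(k/2 + n))` of the moments of `u`. -/
noncomputable def momentDensity (κ k : ℂ) (u : ℂ → ℂ) (j n : ℕ) (z : ℂ) : ℂ :=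
  u z * (z.re : ℂ) ^ κ * ((z.im : ℂ) ^ j * ((1 + Complex.normSq z : ℝ) : ℂ) ^ (-(k / 2 + n)))

theorem norm_one_add_cpow {q : ℝ} (hq : 0 ≤ q) (β : ℂ) :
    ‖((1 + q : ℝ) : ℂ) ^ (-β)‖ = (1 + q) ^ (-β.re) := by
  rw [Complex.norm_cpow_eq_rpow_re_of_pos (by linarith), Complex.neg_re]

theorem norm_one_add_cpow_le_one {q : ℝ} (hq : 0 ≤ q) {β : ℂ} (hβ : 0 ≤ β.re) :
    ‖((1 + q : ℝ) : ℂ) ^ (-β)‖ ≤ 1 := by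
  rw [norm_one_add_cpow hq]
  exact Real.rpow_le_one_of_one_le_of_nonpos (by linarith) (by linarith)

theorem one_add_cpow_succ {q : ℝ} (hq : 0 ≤ q) (β : ℂ) :
    ((1 + q : ℝ) : ℂ) * ((1 + q : ℝ) : ℂ) ^ (-(β + 1)) = ((1 + q : ℝ) : ℂ) ^ (-β) := by
  have h : ((1 + q : ℝ) : ℂ) ≠ 0 := by
    have : (1 + q : ℝ) ≠ 0 := by linarith
    exact_mod_cast this
  rw [show -(β + 1) = -β - 1 by ring, Complex.cpow_sub _ _ h, Complex.cpow_one]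
  field_simp

theorem hasDerivAt_one_add_cpow {q : ℝ} (hq : 0 < q) {β : ℂ} (hβ : β ≠ 0) :
    HasDerivAt (fun q : ℝ => ((1 + q : ℝ) : ℂ) ^ (-β))
      (-β * ((1 + q : ℝ) : ℂ) ^ (-(β + 1))) q := by
  have h1 : HasDerivAt (fun q : ℝ => 1 + q) 1 q := (hasDerivAt_id q).const_add 1
  have h2 := HasDerivAt.scomp q
    (hasDerivAt_ofReal_cpow_const (x := 1 + q) (by linarith) (neg_ne_zero.2 hβ)) h1
  refine h2.congr_deriv ?_
  rw [one_smul, show -(β + 1) = -β - 1 by ring]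

/-- Both `x` and `|y|` are at most `√Q`, where `Q = 1 + |z|²`, while the last factor has norm
`Q^(-Re k / 2 - n)`. The leftover `Q^((Re κ - Re k)/2)` is at most `1`, which is the role of `Re κ ≤
Re k`. -/
theorem norm_cpow_mul_pow_mul_cpow_le {κ k : ℂ} (hκ : 0 ≤ κ.re) (hκk : κ.re ≤ k.re) {z : ℂ}
    (hz : z ∈ rightHalfPlane) (j n : ℕ) :
    ‖(z.re : ℂ) ^ κ‖ * (‖(z.im : ℂ) ^ j‖ *
        ‖((1 + Complex.normSq z : ℝ) : ℂ) ^ (-(k / 2 + n))‖)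
      ≤ (1 + Complex.normSq z) ^ ((j : ℝ) / 2 - n) := by
  have hx : 0 < z.re := hz
  have hq := Complex.normSq_nonneg z
  have hQ : 1 ≤ 1 + Complex.normSq z := by linarith
  have hQ0 : 0 ≤ 1 + Complex.normSq z := by linarith
  have e : Complex.normSq z = z.re * z.re + z.im * z.im := Complex.normSq_apply z
  have bx : z.re ≤ √(1 + Complex.normSq z) :=
    Real.le_sqrt_of_sq_le (by nlinarith [mul_self_nonneg z.im])
  have by' : |z.im| ≤ √(1 + Complex.normSq z) :=
    Real.abs_le_sqrt (by nlinarith [mul_self_nonneg z.re])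
  have b1 : z.re ^ κ.re ≤ (1 + Complex.normSq z) ^ (κ.re / 2) := by
    refine (Real.rpow_le_rpow hx.le bx hκ).trans (le_of_eq ?_)
    rw [Real.sqrt_eq_rpow, ← Real.rpow_mul hQ0]
    congr 1; ring
  have b2 : |z.im| ^ j ≤ (1 + Complex.normSq z) ^ ((j : ℝ) / 2) := by
    refine (pow_le_pow_left₀ (abs_nonneg _) by' j).trans (le_of_eq ?_)
    rw [Real.sqrt_eq_rpow, ← Real.rpow_natCast, ← Real.rpow_mul hQ0]
    congr 1; ring
  rw [Complex.norm_cpow_eq_rpow_re_of_pos hx, norm_one_add_cpow hq, norm_pow, Complex.norm_real,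
    Real.norm_eq_abs]
  calc _ ≤ (1 + Complex.normSq z) ^ (κ.re / 2) * ((1 + Complex.normSq z) ^ ((j : ℝ) / 2) *
        (1 + Complex.normSq z) ^ (-(k / 2 + n).re)) := by gcongr
    _ = (1 + Complex.normSq z) ^ (κ.re / 2 + (j / 2 + -(k / 2 + n).re)) := by
      rw [Real.rpow_add (by linarith), Real.rpow_add (by linarith)]
    _ ≤ _ := by
      apply Real.rpow_le_rpow_of_exponent_le hQ
      have : (k / 2 + n).re = k.re / 2 + n := by
        rw [Complex.add_re, Complex.natCast_re]
        congr 1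
        exact_mod_cast Complex.div_natCast_re k 2
      rw [this]; linarith

theorem continuousOn_momentDensity {κ k : ℂ} {u : ℂ → ℂ} (hu : ContinuousOn u rightHalfPlane)
    (j n : ℕ) : ContinuousOn (momentDensity κ k u j n) rightHalfPlane := by
  refine (hu.mul (continuousOn_ofReal_re_cpow κ)).mul (ContinuousOn.mul
    ((Complex.continuous_ofReal.comp Complex.continuous_im).pow j).continuousOn ?_)
  intro z hz
  have : 0 ≤ Complex.normSq z := Complex.normSq_nonneg z
  exact ContinuousAt.continuousWithinAt <|
    ContinuousAt.comp (f := fun z : ℂ => ((1 + Complex.normSq z : ℝ) : ℂ))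
      (continuousAt_cpow_const (Or.inl (by rw [Complex.ofReal_re]; linarith)))
      (Complex.continuous_ofReal.comp
        (continuous_const.add Complex.continuous_normSq)).continuousAt

/-- When `j + 2 ≤ n` the exponent `j/2 - n` is at most `-2`, and `(1 + |z|²)⁻²` is integrable over
the plane. -/
theorem integrableOn_momentDensity {κ k : ℂ} (hκ : 0 ≤ κ.re) (hκk : κ.re ≤ k.re) {u : ℂ → ℂ}
    (hu : ContinuousOn u rightHalfPlane) {M : ℝ} (hM0 : 0 ≤ M)
    (hM : ∀ z ∈ rightHalfPlane, ‖u z‖ ≤ M) {j n : ℕ} (hjn : j + 2 ≤ n) :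
    IntegrableOn (momentDensity κ k u j n) rightHalfPlane := by
  have hi : Integrable (fun z : ℂ => M * ((1 : ℝ) + ‖z‖ ^ 2) ^ (-(4 : ℝ) / 2)) :=
    (integrable_rpow_neg_one_add_norm_sq (by simp; norm_num)).const_mul M
  refine Integrable.mono' hi.integrableOn ((continuousOn_momentDensity hu j n).aestronglyMeasurable
    isOpen_rightHalfPlane.measurableSet) ?_
  refine (ae_restrict_iff' isOpen_rightHalfPlane.measurableSet).2 (Eventually.of_forall ?_)
  intro z hz
  rw [momentDensity, norm_mul, norm_mul, norm_mul, mul_assoc]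
  refine mul_le_mul (hM z hz) ((norm_cpow_mul_pow_mul_cpow_le hκ hκk hz j n).trans ?_)
    (by positivity) hM0
  rw [← Complex.normSq_eq_norm_sq]
  refine Real.rpow_le_rpow_of_exponent_le (by linarith [Complex.normSq_nonneg z]) ?_
  have : (j : ℝ) + 2 ≤ n := by exact_mod_cast hjn
  have : (0 : ℝ) ≤ j := by positivity
  linarith

/-! ### The moment recurrence and the vanishing of moments -/

set_option maxHeartbeats 1000000 in
/-- The recurrence between the moments of a solution of `L_m u = 0` vanishing at the boundary. -/
theorem moment_recurrence {m κ k : ℂ} (hκ : (κ - 1) * (κ - m) = 0)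
    (hk : k = 2 * κ - m) (hre : 1 ≤ κ.re) (hκk : κ.re ≤ k.re) {u : ℂ → ℂ}
    (hu : ContDiffOn ℝ 2 u rightHalfPlane) (hL : ∀ z ∈ rightHalfPlane, weinsteinOp m u z = 0)
    (hlim : TendsToZeroAtBoundary u) {j n : ℕ} (hjn : j ≤ n) {α : ℂ} (hα : α = k / 2 + n) :
    j * (j - 1) * (∫ z in rightHalfPlane, momentDensity κ k u (j - 2) n z)
      + 4 * α * (n - j) * (∫ z in rightHalfPlane, momentDensity κ k u j (n + 1) z)
      - 4 * α * (α + 1) * (∫ z in rightHalfPlane, momentDensity κ k u j (n + 2) z) = 0 := by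
  have hH := isOpen_rightHalfPlane.measurableSet
  have cu := hu.continuousOn
  obtain ⟨η, η1, η2, B', hB', dη, dη1, cη2, ηlo, ηhi, bη, bη1, bη2⟩ := exists_smooth_step
  obtain ⟨M, hM0, hM⟩ := hlim.bounded cu
  have cη : Continuous η := continuous_iff_continuousAt.2 fun y => (dη y).continuousAt
  have cη1 : Continuous η1 := continuous_iff_continuousAt.2 fun y => (dη1 y).continuousAt
  have hαre : α.re = k.re / 2 + n := by
    rw [hα, Complex.add_re, Complex.natCast_re]
    congr 1
    exact_mod_cast Complex.div_natCast_re k 2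
  have hα_pos : 0 < α.re := by
    rw [hαre]
    have : (0 : ℝ) ≤ n := by positivity
    linarith
  have hα0 : α ≠ 0 := fun h => by rw [h] at hα_pos; simp at hα_pos
  have hα1_pos : 0 < (α + 1).re := by rw [Complex.add_re, Complex.one_re]; linarith
  have hα1 : α + 1 ≠ 0 := fun h => by rw [h] at hα1_pos; simp at hα1_pos
  have hα2_pos : 0 < (α + 1 + 1).re := by
    rw [Complex.add_re, Complex.one_re]; linarith
  -- the powers of `1 + q`
  set g : ℂ → ℝ → ℂ := fun β q => ((1 + q : ℝ) : ℂ) ^ (-β) with hg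
  have dg : ∀ {β : ℂ}, β ≠ 0 → ∀ q, 0 < q → HasDerivAt (g β) (-β * g (β + 1) q) q :=
    fun hβ q hq => hasDerivAt_one_add_cpow hq hβ
  have cg : ∀ β, ContinuousOn (g β) (Ioi 0) := fun β q hq => ContinuousAt.continuousWithinAt <|
    ContinuousAt.comp (f := fun q : ℝ => ((1 + q : ℝ) : ℂ))
      (continuousAt_cpow_const (Or.inl (by
        rw [Complex.ofReal_re]; linarith [show (0 : ℝ) < q from hq])))
      (Complex.continuous_ofReal.comp (continuous_const.add continuous_id)).continuousAt
  have bg : ∀ {β : ℂ}, 0 < β.re → ∀ q, 0 < q → ‖g β q‖ ≤ 1 :=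
    fun hβ q hq => norm_one_add_cpow_le_one hq.le hβ.le
  have sg : ∀ β q, 0 ≤ q → ((1 + q : ℝ) : ℂ) * g (β + 1) q = g β q :=
    fun β q hq => one_add_cpow_succ hq β
  -- the limit density
  set f : ℂ → ℂ := fun z => j * (j - 1) * momentDensity κ k u (j - 2) n z
      + 4 * α * (n - j) * momentDensity κ k u j (n + 1) z
      - 4 * α * (α + 1) * momentDensity κ k u j (n + 2) z with hf
  have i1 : IntegrableOn (fun z => (j : ℂ) * (j - 1) * momentDensity κ k u (j - 2) n z)
      rightHalfPlane := by
    -- For `j < 2` the truncated index `j - 2` is meaningless, but its coefficient `j(j - 1)` is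
    -- zero.
    rcases lt_or_ge j 2 with h | h
    · have : (j : ℂ) * (j - 1) = 0 := by interval_cases j <;> simp
      simp only [this, zero_mul]
      exact integrableOn_zero
    · exact (integrableOn_momentDensity (by linarith) hκk cu hM0.le hM (by omega)).const_mul _
  have i2 : IntegrableOn (fun z => 4 * α * ((n : ℂ) - j) * momentDensity κ k u j (n + 1) z)
      rightHalfPlane := by
    -- At `n = j` the decay is one power short of the integrability criterion; the coefficient `n -
    -- j` vanishes exactly there.
    rcases hjn.eq_or_lt with h | h
    · subst h
      simp only [sub_self, mul_zero, zero_mul]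
      exact integrableOn_zero
    · exact (integrableOn_momentDensity (by linarith) hκk cu hM0.le hM (by omega)).const_mul _
  have i3 : IntegrableOn (fun z => 4 * α * (α + 1) * momentDensity κ k u j (n + 2) z)
      rightHalfPlane :=
    (integrableOn_momentDensity (by linarith) hκk cu hM0.le hM (by omega)).const_mul _
  have fi : IntegrableOn f rightHalfPlane := (i1.add i2).sub i3
  have cf : ContinuousOn f rightHalfPlane :=
    ((continuousOn_const.mul (continuousOn_momentDensity cu _ _)).add
      (continuousOn_const.mul (continuousOn_momentDensity cu _ _))).sub
      (continuousOn_const.mul (continuousOn_momentDensity cu _ _))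
  suffices hf0 : ∫ z in rightHalfPlane, f z = 0 by
    have e12 := integral_add i1 i2
    have i12 : IntegrableOn (fun z => (j : ℂ) * (j - 1) * momentDensity κ k u (j - 2) n z
        + 4 * α * (n - j) * momentDensity κ k u j (n + 1) z) rightHalfPlane := i1.add i2
    have e123 := integral_sub i12 i3
    rw [e12, integral_const_mul, integral_const_mul, integral_const_mul] at e123
    rw [← e123]
    exact hf0
  -- the identity with a cutoff at infinity
  set E : ℝ → ℂ → ℂ := fun R z => u z * ((z.re : ℂ) ^ κ * ((z.im : ℂ) ^ j *
      (-((4 + 4 * j + 2 * k) * ((η1 (Complex.normSq z / R ^ 2) : ℝ) / (R : ℂ) ^ 2) *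
          g α (Complex.normSq z))
        + 8 * α * ((η1 (Complex.normSq z / R ^ 2) : ℝ) / (R : ℂ) ^ 2) *
          (Complex.normSq z * g (α + 1) (Complex.normSq z))
        - 4 * Complex.normSq z * ((η2 (Complex.normSq z / R ^ 2) : ℝ) / (R : ℂ) ^ 4) *
          g α (Complex.normSq z)))) with hE
  -- The test function is `x^κ y^j (1 - η(q/R²)) (1 + q)^(-α)` with `q = x² + y²`; `E R` collects
  -- the terms where the cutoff is differentiated.
  have ident : ∀ R ≥ (1 : ℝ), ∫ z in rightHalfPlane,
      (f z * (1 - η (Complex.normSq z / R ^ 2) : ℝ) + E R z) = 0 := by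
    intro R hR
    have hR0 : 0 < R := by linarith
    have hR' : (R : ℂ) ≠ 0 := by simpa using hR0.ne'
    have dsc : ∀ {b b' : ℝ → ℝ}, (∀ s, HasDerivAt b (b' s) s) → ∀ q : ℝ,
        HasDerivAt (fun q : ℝ => ((b (q / R ^ 2) : ℝ) : ℂ))
          ((b' (q / R ^ 2) : ℝ) / (R : ℂ) ^ 2 : ℂ) q := by
      intro b b' hb q
      have h1 : HasDerivAt (fun q : ℝ => q / R ^ 2) (1 / R ^ 2) q :=
        (hasDerivAt_id q).div_const (R ^ 2)
      have h2 := ((hb (q / R ^ 2)).comp q h1).ofReal_comp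
      refine h2.congr_deriv ?_
      push_cast; ring
    have cc : ∀ {b : ℝ → ℝ}, Continuous b →
        ContinuousOn (fun q : ℝ => ((b (q / R ^ 2) : ℝ) : ℂ)) (Ioi 0) := fun hb =>
      (Complex.continuous_ofReal.comp (hb.comp (continuous_id.div_const _))).continuousOn
    have dy : ∀ (i : ℕ) (y : ℝ), HasDerivAt (fun y : ℝ => (y : ℂ) ^ i) (i * (y : ℂ) ^ (i - 1)) y :=
      fun i y => by
        have h1 : HasDerivAt (fun y : ℝ => (y : ℂ)) 1 y := by
          simpa using (hasDerivAt_id y).ofReal_comp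
        simpa using h1.fun_pow i
    -- `B` is the sum of the separate bounds for `h`, `h1`, `h2`; negative powers of `R` are dropped
    -- since `R ≥ 1`.
    have key := integral_mul_cpow_mul_eq_zero hκ hk hre hu hL hlim (C := 2 * R ^ 2)
      (B := 2 + (‖α‖ * 2 + B') + (‖α‖ * ‖α + 1‖ * 2 + 2 * ‖α‖ * B' + B'))
      (by positivity)
      (p := fun y => (y : ℂ) ^ j) (p1 := fun y => j * (y : ℂ) ^ (j - 1))
      (p2 := fun y => j * ((j - 1 : ℕ) * (y : ℂ) ^ (j - 1 - 1)))
      (h := fun q => (1 - (η (q / R ^ 2) : ℝ)) * g α q)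
      (h1 := fun q => -((η1 (q / R ^ 2) : ℝ) / (R : ℂ) ^ 2) * g α q
        + (1 - (η (q / R ^ 2) : ℝ)) * (-α * g (α + 1) q))
      (h2 := fun q => -((η2 (q / R ^ 2) : ℝ) / (R : ℂ) ^ 4) * g α q
        + 2 * α * ((η1 (q / R ^ 2) : ℝ) / (R : ℂ) ^ 2) * g (α + 1) q
        + (1 - (η (q / R ^ 2) : ℝ)) * (α * (α + 1) * g (α + 1 + 1) q))
      (fun y => dy j y) (fun y => (dy (j - 1) y).const_mul _) (by fun_prop) ?_ ?_ ?_ ?_ ?_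
    · rw [← key]
      refine setIntegral_congr_fun hH fun z hz => ?_
      have hq := Complex.normSq_nonneg z
      have s1 := sg α _ hq
      have s2 := sg (α + 1) _ hq
      have ej : (j : ℂ) * ((j - 1 : ℕ) * (z.im : ℂ) ^ (j - 1 - 1))
          = j * (j - 1) * (z.im : ℂ) ^ (j - 2) := by
        rcases j with _ | j
        · simp
        · rw [Nat.sub_sub]; push_cast; simp; ring
      have ey : (z.im : ℂ) * (j * (z.im : ℂ) ^ (j - 1)) = j * (z.im : ℂ) ^ j := by
        rcases j with _ | j
        · simp
        · simp; ring
      have g0 : ((1 + Complex.normSq z : ℝ) : ℂ) ^ (-(k / 2 + n)) = g α (Complex.normSq z) := by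
        rw [hg, hα]
      have g1 : ((1 + Complex.normSq z : ℝ) : ℂ) ^ (-(k / 2 + (n + 1 : ℕ)))
          = g (α + 1) (Complex.normSq z) := by
        simp only [hg, hα]; push_cast; rw [add_assoc]
      have g2 : ((1 + Complex.normSq z : ℝ) : ℂ) ^ (-(k / 2 + (n + 2 : ℕ)))
          = g (α + 1 + 1) (Complex.normSq z) := by
        simp only [hg, hα]; push_cast; congr 2; ring
      simp only [hf, hE, momentDensity, g0, g1, g2, ej, ey]
      -- With `q = Q - 1` in `4 q α (α + 1) Q^(-α - 2)`, the coefficient of `y^j Q^(-α - 1)` becomes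
      -- `α (4α - 2k - 4j)`, which equals `4α(n - j)` because `α = k/2 + n`.
      have hn : (n : ℂ) = α - k / 2 := by rw [hα]; ring
      rw [hn]
      push_cast at s1 s2 ⊢
      linear_combination (-4 * α * (α + 1) * u z * (z.re : ℂ) ^ κ * (z.im : ℂ) ^ j *
        (1 - (η (Complex.normSq z / R ^ 2) : ℂ))) * s2
    · intro q hq
      refine (((dsc dη q).const_sub 1).fun_mul (dg hα0 q hq)).congr_deriv ?_
      ring
    · intro q hq
      refine (((((dsc dη1 q).div_const ((R : ℂ) ^ 2)).fun_neg).fun_mul (dg hα0 q hq)).fun_add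
        (((dsc dη q).const_sub 1).fun_mul ((dg hα1 q hq).const_mul (-α)))).congr_deriv ?_
      field_simp
      ring
    · exact ((((cc cη2).div_const _).neg.mul (cg _)).add ((continuousOn_const.mul
        ((cc cη1).div_const _)).mul (cg _))).add ((continuousOn_const.sub (cc cη)).mul
        (continuousOn_const.mul (cg _)))
    · intro q hq
      obtain ⟨e1, e2, e3⟩ := ηhi (q / R ^ 2) ((lt_div_iff₀ (by positivity)).2 hq)
      simp [e1, e2, e3]
    · intro q hq
      have a0 := bg hα_pos q hq
      have a1 := bg hα1_pos q hq
      have a2 := bg hα2_pos q hq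
      have b0 : ‖(1 - (η (q / R ^ 2) : ℝ) : ℂ)‖ ≤ 2 := by
        refine (norm_sub_le _ _).trans ?_
        rw [norm_one, Complex.norm_real, Real.norm_eq_abs]
        linarith [bη (q / R ^ 2)]
      have nR : ‖(R : ℂ)‖ = R := by simp [abs_of_pos hR0]
      have b1 : ‖((η1 (q / R ^ 2) : ℝ) : ℂ) / (R : ℂ) ^ 2‖ ≤ B' := by
        rw [norm_div, norm_pow, nR, Complex.norm_real, Real.norm_eq_abs]
        exact (div_le_self (abs_nonneg _) (one_le_pow₀ hR)).trans (bη1 _)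
      have b2 : ‖((η2 (q / R ^ 2) : ℝ) : ℂ) / (R : ℂ) ^ 4‖ ≤ B' := by
        rw [norm_div, norm_pow, nR, Complex.norm_real, Real.norm_eq_abs]
        exact (div_le_self (abs_nonneg _) (one_le_pow₀ hR)).trans (bη2 _)
      have n2 : ‖(2 : ℂ)‖ = 2 := by norm_num
      have p1 : 0 ≤ ‖α‖ * 2 + B' := by positivity
      have p2 : 0 ≤ ‖α‖ * ‖α + 1‖ * 2 + 2 * ‖α‖ * B' + B' := by positivity
      refine ⟨?_, ?_, ?_⟩
      · rw [norm_mul]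
        calc _ ≤ 2 * (1 : ℝ) := by gcongr
          _ ≤ _ := by linarith
      · refine (norm_add_le _ _).trans ?_
        simp only [norm_mul, norm_neg]
        calc _ ≤ B' * 1 + 2 * (‖α‖ * 1) := by gcongr
          _ ≤ _ := by linarith
      · refine (norm_add₃_le).trans ?_
        simp only [norm_mul, norm_neg, n2]
        calc _ ≤ B' * 1 + 2 * ‖α‖ * B' * 1 + 2 * (‖α‖ * ‖α + 1‖ * 1) := by gcongr
          _ ≤ _ := by linarith
  have c_q : ∀ {b : ℝ → ℂ}, ContinuousOn b (Ioi 0) →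
      ContinuousOn (fun z : ℂ => b (Complex.normSq z)) rightHalfPlane := fun hb =>
    hb.comp Complex.continuous_normSq.continuousOn fun z hz => normSq_pos_of_mem hz
  have cR : ∀ {b : ℝ → ℝ}, Continuous b → ∀ R : ℝ,
      ContinuousOn (fun z : ℂ => ((b (Complex.normSq z / R ^ 2) : ℝ) : ℂ)) rightHalfPlane :=
    fun hb R => (Complex.continuous_ofReal.comp
      (hb.comp (Complex.continuous_normSq.div_const _))).continuousOn
  have cn : ContinuousOn (fun z : ℂ => ((Complex.normSq z : ℝ) : ℂ)) rightHalfPlane :=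
    (Complex.continuous_ofReal.comp Complex.continuous_normSq).continuousOn
  have cE : ∀ R, ContinuousOn (E R) rightHalfPlane := fun R =>
    cu.mul ((continuousOn_ofReal_re_cpow κ).mul
      (((Complex.continuous_ofReal.comp Complex.continuous_im).pow j).continuousOn.mul
        ((((continuousOn_const.mul ((cR cη1 R).div_const _)).mul (c_q (cg α))).neg.add
          ((continuousOn_const.mul ((cR cη1 R).div_const _)).mul (cn.mul (c_q (cg (α + 1)))))).sub
          (((continuousOn_const.mul cn).mul ((cR cη2 R).div_const _)).mul (c_q (cg α))))))
  -- the error term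
  set D : ℝ := (‖4 + 4 * j + 2 * k‖ + 8 * ‖α‖ + 8) * B' with hD
  have hD0 : 0 ≤ D := by positivity
  -- `E R` is supported in `R² ≤ |z|² ≤ 2R²`, where `|u| ≤ ε`. There `|x^κ y^j Q^(-α)| ≤ 1` because
  -- `j ≤ n`, and the cutoff derivatives contribute `O(R⁻²)`, against an area `4πR²`. No decay rate
  -- of `u` is needed.
  have err : ∀ ε > 0, ∃ R0 ≥ (1 : ℝ), ∀ R ≥ R0, IntegrableOn (E R) rightHalfPlane ∧
      ‖∫ z in rightHalfPlane, E R z‖ ≤ ε * D * (4 * Real.pi) := by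
    intro ε hε
    obtain ⟨R0, hR0, hs⟩ := hlim.norm_le_of_le_norm hε
    refine ⟨max 1 R0, le_max_left _ _, fun R hR => ?_⟩
    have hR1 : 1 ≤ R := (le_max_left _ _).trans hR
    have hRp : 0 < R := by linarith
    have hRR : R0 ≤ R := (le_max_right _ _).trans hR
    have hv : volume.real (Metric.closedBall (0 : ℂ) (2 * R)) = R ^ 2 * (4 * Real.pi) := by
      rw [measureReal_def, Complex.volume_closedBall, ENNReal.toReal_mul, ENNReal.toReal_pow,
        ENNReal.toReal_ofReal (by positivity)]
      simp
      ring
    have zero_of : ∀ z : ℂ, Complex.normSq z < R ^ 2 ∨ 2 * R ^ 2 < Complex.normSq z →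
        E R z = 0 := by
      intro z hz
      have : η1 (Complex.normSq z / R ^ 2) = 0 ∧ η2 (Complex.normSq z / R ^ 2) = 0 := by
        rcases hz with hz | hz
        · exact (ηlo _ ((div_lt_one (by positivity)).2 hz)).2
        · exact (ηhi _ ((lt_div_iff₀ (by positivity)).2 hz)).2
      simp [hE, this.1, this.2]
    have := integrableOn_and_norm_integral_le (S := Metric.closedBall (0 : ℂ) (2 * R))
      (D := ε * (D / R ^ 2)) (cE R) Metric.isClosed_closedBall.measurableSet
      measure_closedBall_lt_top (by positivity) ?_ ?_
    · refine ⟨this.1, this.2.trans (le_of_eq ?_)⟩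
      rw [hv]; field_simp
    · intro z hz _
      by_cases hzR : Complex.normSq z < R ^ 2 ∨ 2 * R ^ 2 < Complex.normSq z
      · rw [zero_of z hzR, norm_zero]; positivity
      push Not at hzR
      obtain ⟨hlo, hhi⟩ := hzR
      have hq0 := Complex.normSq_nonneg z
      have hzn : R ≤ ‖z‖ := by
        rw [Complex.normSq_eq_norm_sq] at hlo
        exact le_of_sq_le_sq hlo (norm_nonneg z)
      have nR : ‖(R : ℂ)‖ = R := by simp [abs_of_pos hRp]
      have nq : ‖((Complex.normSq z : ℝ) : ℂ)‖ = Complex.normSq z := by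
        rw [Complex.norm_real, Real.norm_eq_abs, abs_of_nonneg hq0]
      have n1 : ‖((η1 (Complex.normSq z / R ^ 2) : ℝ) : ℂ)‖ ≤ B' := by
        rw [Complex.norm_real]; exact bη1 _
      have n2 : ‖((η2 (Complex.normSq z / R ^ 2) : ℝ) : ℂ)‖ ≤ B' := by
        rw [Complex.norm_real]; exact bη2 _
      have n4 : ‖(4 : ℂ)‖ = 4 := by norm_num
      have n8 : ‖(8 : ℂ)‖ = 8 := by norm_num
      set G := ‖g α (Complex.normSq z)‖ with hG
      have hG1 : Complex.normSq z * ‖g (α + 1) (Complex.normSq z)‖ ≤ G := by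
        rw [hG, ← sg α _ hq0, norm_mul, Complex.norm_real, Real.norm_eq_abs,
          abs_of_nonneg (by linarith)]
        gcongr
        linarith
      have hW : ‖(z.re : ℂ) ^ κ‖ * (‖(z.im : ℂ) ^ j‖ * G) ≤ 1 := by
        have := norm_cpow_mul_pow_mul_cpow_le (by linarith) hκk hz j n
        rw [← hα] at this
        refine this.trans (Real.rpow_le_one_of_one_le_of_nonpos (by linarith) ?_)
        have h1 : (j : ℝ) ≤ n := by exact_mod_cast hjn
        have h2 : (0 : ℝ) ≤ j := by positivity
        linarith
      rw [hE]
      simp only [norm_mul]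
      refine mul_le_mul (hs z hz (hRR.trans hzn)) ?_ (by positivity) hε.le
      have q3 : ‖-((4 + 4 * j + 2 * k) * ((η1 (Complex.normSq z / R ^ 2) : ℝ) / (R : ℂ) ^ 2) *
          g α (Complex.normSq z))
        + 8 * α * ((η1 (Complex.normSq z / R ^ 2) : ℝ) / (R : ℂ) ^ 2) *
          (Complex.normSq z * g (α + 1) (Complex.normSq z))
        - 4 * Complex.normSq z * ((η2 (Complex.normSq z / R ^ 2) : ℝ) / (R : ℂ) ^ 4) *
          g α (Complex.normSq z)‖ ≤ D / R ^ 2 * G := by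
        refine (norm_sub_le _ _).trans ((add_le_add_left (norm_add_le _ _) _).trans ?_)
        simp only [norm_mul, norm_neg, norm_div, norm_pow, nR, nq, n4, n8]
        calc _ ≤ ‖4 + 4 * (j : ℂ) + 2 * k‖ * (B' / R ^ 2) * G + 8 * ‖α‖ * (B' / R ^ 2) * G
              + 4 * (2 * R ^ 2) * (B' / R ^ 4) * G := by gcongr
          _ = _ := by rw [hD]; field_simp; ring
      calc _ ≤ ‖(z.re : ℂ) ^ κ‖ * (‖(z.im : ℂ) ^ j‖ * (D / R ^ 2 * G)) := by gcongr
        _ = D / R ^ 2 * (‖(z.re : ℂ) ^ κ‖ * (‖(z.im : ℂ) ^ j‖ * G)) := by ring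
        _ ≤ D / R ^ 2 * 1 := by gcongr
        _ = D / R ^ 2 := mul_one _
    · intro z _ hzS
      apply zero_of z
      right
      rw [mem_closedBall_zero_iff, not_le] at hzS
      rw [Complex.normSq_eq_norm_sq]
      nlinarith
  -- passage to the limit
  have bψ : ∀ s, ‖(((1 - η s : ℝ)) : ℂ)‖ ≤ 2 := fun s => by
    rw [Complex.norm_real, Real.norm_eq_abs]
    refine (abs_sub _ _).trans ?_
    rw [abs_one]; linarith [bη s]
  have cψ : Continuous fun s => 1 - η s := continuous_const.sub cη
  have fψ : ∀ R, IntegrableOn (fun z => f z * (1 - η (Complex.normSq z / R ^ 2) : ℝ))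
      rightHalfPlane := fun R => by
    refine Integrable.mono' (fi.norm.mul_const 2) ((cf.mul (cR cψ R)).aestronglyMeasurable hH) ?_
    filter_upwards with z
    rw [norm_mul]
    exact mul_le_mul_of_nonneg_left (bψ _) (norm_nonneg _)
  have lim1 : Tendsto (fun R : ℝ => ∫ z in rightHalfPlane,
      f z * (1 - η (Complex.normSq z / R ^ 2) : ℝ)) atTop (𝓝 (∫ z in rightHalfPlane, f z)) := by
    refine tendsto_integral_filter_of_dominated_convergence (fun z => ‖f z‖ * 2) ?_ ?_
      (fi.norm.mul_const 2) ?_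
    · filter_upwards with R using (cf.mul (cR cψ R)).aestronglyMeasurable hH
    · filter_upwards with R
      filter_upwards with z
      rw [norm_mul]
      exact mul_le_mul_of_nonneg_left (bψ _) (norm_nonneg _)
    · filter_upwards with z
      refine tendsto_const_nhds.congr' ?_
      filter_upwards [eventually_gt_atTop ‖z‖] with R hR
      have hRp : 0 < R := (norm_nonneg z).trans_lt hR
      rw [(ηlo (Complex.normSq z / R ^ 2) ((div_lt_one (by positivity)).2 (by
        rw [Complex.normSq_eq_norm_sq]; gcongr))).1]
      simp
  have lim2 : Tendsto (fun R : ℝ => ∫ z in rightHalfPlane,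
      f z * (1 - η (Complex.normSq z / R ^ 2) : ℝ)) atTop (𝓝 0) := by
    rw [Metric.tendsto_nhds]
    intro ε hε
    obtain ⟨R0, hR0, hs⟩ := err (ε / (2 * (D * (4 * Real.pi) + 1))) (by positivity)
    filter_upwards [eventually_ge_atTop R0] with R hR
    obtain ⟨e1, e2⟩ := hs R hR
    have h3 := ident R (hR0.le.trans hR)
    rw [integral_add (fψ R) e1] at h3
    rw [dist_zero_right, eq_neg_of_add_eq_zero_left h3, norm_neg]
    refine e2.trans_lt ?_
    have hK : 0 ≤ D * (4 * Real.pi) := by positivity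
    rw [mul_assoc, div_mul_eq_mul_div, div_lt_iff₀ (by positivity)]
    nlinarith
  exact tendsto_nhds_unique lim1 lim2

/-- All the moments `∫ u x^κ y^j (1 + x² + y²)^(-(k/2 + n))` with `j + 2 ≤ n` vanish. -/
theorem integral_momentDensity_eq_zero {m κ k : ℂ} (hκ : (κ - 1) * (κ - m) = 0)
    (hk : k = 2 * κ - m) (hre : 1 ≤ κ.re) (hκk : κ.re ≤ k.re) {u : ℂ → ℂ}
    (hu : ContDiffOn ℝ 2 u rightHalfPlane) (hL : ∀ z ∈ rightHalfPlane, weinsteinOp m u z = 0)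
    (hlim : TendsToZeroAtBoundary u) (j : ℕ) :
    ∀ n, j ≤ n → ∫ z in rightHalfPlane, momentDensity κ k u j (n + 2) z = 0 := by
  -- The top coefficient `4α(α + 1)` is nonzero because `Re k ≥ 1` makes `Re α` positive, so the
  -- highest moment is determined by the other two.
  have solve : ∀ {j n : ℕ}, j ≤ n →
      (j : ℂ) * (j - 1) * (∫ z in rightHalfPlane, momentDensity κ k u (j - 2) n z) = 0 →
      ((n : ℂ) - j) * (∫ z in rightHalfPlane, momentDensity κ k u j (n + 1) z) = 0 →
      ∫ z in rightHalfPlane, momentDensity κ k u j (n + 2) z = 0 := by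
    intro j n hjn h1 h2
    have h := moment_recurrence hκ hk hre hκk hu hL hlim hjn rfl
    have hre' : (k / 2 + n).re = k.re / 2 + n := by
      rw [Complex.add_re, Complex.natCast_re]
      congr 1
      exact_mod_cast Complex.div_natCast_re k 2
    have hpos : 0 < (k / 2 + n).re := by
      rw [hre']
      have : (0 : ℝ) ≤ n := by positivity
      linarith
    have ha : k / 2 + n ≠ 0 := fun h => by rw [h] at hpos; simp at hpos
    have hb : k / 2 + n + 1 ≠ 0 := fun h => by
      have := congrArg Complex.re h
      rw [Complex.add_re, Complex.one_re, Complex.zero_re] at this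
      linarith
    rw [h1, mul_assoc, h2] at h
    simpa [ha, hb] using h
  have step : ∀ j : ℕ, (∀ n, j ≤ n →
      (j : ℂ) * (j - 1) * (∫ z in rightHalfPlane, momentDensity κ k u (j - 2) n z) = 0) →
      ∀ n, j ≤ n → ∫ z in rightHalfPlane, momentDensity κ k u j (n + 2) z = 0 := by
    intro j hj n hn
    -- The induction starts by itself at `n = j`, where the middle term carries the factor `n - j =
    -- 0`.
    induction n, hn using Nat.le_induction with
    | base => exact solve le_rfl (hj j le_rfl) (by simp)
    | succ n hn ih =>
      refine solve (hn.trans n.le_succ) (hj _ (hn.trans n.le_succ)) ?_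
      rw [ih, mul_zero]
  induction j using Nat.strong_induction_on with
  | _ j ih =>
    refine step j fun n hn => ?_
    rcases lt_or_ge j 2 with h | h
    · have : (j : ℂ) * (j - 1) = 0 := by interval_cases j <;> simp
      rw [this, zero_mul]
    -- The moment of index `(j - 2, n)` is covered by the hypothesis at `n - 2`, since `n = (n - 2)
    -- + 2`.
    · have := ih (j - 2) (by omega) (n - 2) (by omega)
      rw [Nat.sub_add_cancel (h.trans hn)] at this
      rw [this, mul_zero]

/-! ### From vanishing moments to orthogonality: the bounded chart -/

/-- The bounded chart `x + iy ↦ (1 + iy) / (1 + x² + y²)`, injective on the half-plane. -/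
noncomputable def boundedChart (z : ℂ) : ℂ :=
  ⟨(1 + Complex.normSq z)⁻¹, z.im * (1 + Complex.normSq z)⁻¹⟩

theorem continuous_boundedChart : Continuous boundedChart := by
  have h : Continuous fun z : ℂ => (1 + Complex.normSq z)⁻¹ :=
    (continuous_const.add Complex.continuous_normSq).inv₀ fun z =>
      (add_pos_of_pos_of_nonneg one_pos (Complex.normSq_nonneg z)).ne'
  exact Complex.equivRealProdCLM.symm.continuous.comp
    (h.prodMk (Complex.continuous_im.mul h))

/-- Boundedness places the image in a compact set, where polynomials approximate continuous
functions uniformly. The squared norm is `(1 + y²)/Q²`, and `1 + y² ≤ Q ≤ Q²`. -/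
theorem boundedChart_mem_closedBall (z : ℂ) : boundedChart z ∈ Metric.closedBall (0 : ℂ) 1 := by
  have hq := Complex.normSq_nonneg z
  have e : Complex.normSq z = z.re * z.re + z.im * z.im := Complex.normSq_apply z
  rw [mem_closedBall_zero_iff]
  refine abs_le_of_sq_le_sq' ?_ zero_le_one |>.2
  rw [← Complex.normSq_eq_norm_sq, Complex.normSq_apply]
  simp only [boundedChart]
  set Q := 1 + Complex.normSq z with hQ
  have hQ0 : 0 < Q := by linarith
  have : Q⁻¹ * Q⁻¹ + z.im * Q⁻¹ * (z.im * Q⁻¹) = (1 + z.im * z.im) / Q ^ 2 := by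
    field_simp
  rw [this, div_le_iff₀ (by positivity)]
  nlinarith [mul_self_nonneg z.re]

/-- A complex density on the half-plane all of whose moments in the chart vanish is orthogonal to
every continuous function of the chart. -/
theorem integral_mul_comp_boundedChart_eq_zero {f : ℂ → ℂ} (hf : IntegrableOn f rightHalfPlane)
    (h0 : ∀ a j : ℕ, ∫ z in rightHalfPlane,
      f z * (((boundedChart z).re ^ a * (boundedChart z).im ^ j : ℝ) : ℂ) = 0)
    {Φ : ℂ → ℝ} (hΦ : Continuous Φ) :
    ∫ z in rightHalfPlane, f z * (Φ (boundedChart z) : ℂ) = 0 := by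
  set X : C(ℂ, ℝ) := ⟨Complex.re, Complex.continuous_re⟩
  set Y : C(ℂ, ℝ) := ⟨Complex.im, Complex.continuous_im⟩
  have hK : IsCompact (Metric.closedBall (0 : ℂ) 1) := isCompact_closedBall _ _
  have hi : ∀ p : C(ℂ, ℝ), IntegrableOn (fun z => f z * (p (boundedChart z) : ℂ))
      rightHalfPlane := by
    intro p
    obtain ⟨c, hc⟩ := hK.exists_bound_of_continuousOn p.continuous.continuousOn
    refine Integrable.mono' (hf.norm.mul_const c) (hf.aestronglyMeasurable.mul
      (Complex.continuous_ofReal.comp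
        (p.continuous.comp continuous_boundedChart)).aestronglyMeasurable) ?_
    filter_upwards with z
    rw [norm_mul, Complex.norm_real]
    exact mul_le_mul_of_nonneg_left (hc _ (boundedChart_mem_closedBall z)) (norm_nonneg _)
  set A := Algebra.adjoin ℝ ({X, Y} : Set C(ℂ, ℝ)) with hA
  have sep : A.SeparatesPoints := by
    intro z w hzw
    by_cases h : z.re = w.re
    · exact ⟨Y, ⟨Y, Algebra.subset_adjoin (by simp), rfl⟩, fun h' => hzw (Complex.ext h h')⟩
    · exact ⟨X, ⟨X, Algebra.subset_adjoin (by simp), rfl⟩, h⟩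
  have hpoly : ∀ p ∈ A, ∫ z in rightHalfPlane, f z * (p (boundedChart z) : ℂ) = 0 := by
    intro p hp
    -- The algebra generated by the two coordinates is spanned by the monomials, for which the
    -- integral vanishes by `h0`.
    rw [← Subalgebra.mem_toSubmodule, hA, Algebra.adjoin_eq_span] at hp
    induction hp using Submodule.span_induction with
    | mem p hp =>
      obtain ⟨a, j, rfl⟩ := (Submonoid.mem_closure_pair _ _ _).1 hp
      exact h0 a j
    | zero => simp
    | add p q _ _ hp hq =>
      have := integral_add (hi p) (hi q)
      rw [hp, hq, add_zero] at this
      rw [← this]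
      congr 1 with z
      simp [mul_add]
    | smul c p _ hp =>
      have := integral_const_mul (μ := volume.restrict rightHalfPlane) (c : ℂ)
        (fun z => f z * (p (boundedChart z) : ℂ))
      rw [hp, mul_zero] at this
      rw [← this]
      congr 1 with z
      simp only [ContinuousMap.smul_apply, smul_eq_mul]
      push_cast
      ring
  rw [← norm_le_zero_iff]
  refine le_of_forall_pos_le_add fun ε hε => ?_
  set I := ∫ z in rightHalfPlane, ‖f z‖ with hI
  have hI0 : 0 ≤ I := integral_nonneg fun _ => norm_nonneg _
  obtain ⟨p, hp, hpΦ⟩ :=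
    ContinuousMap.exists_mem_subalgebra_near_continuous_of_isCompact_of_separatesPoints sep
      ⟨Φ, hΦ⟩ hK (ε := ε / (I + 1)) (by positivity)
  have e : ∫ z in rightHalfPlane, f z * (Φ (boundedChart z) : ℂ)
      = ∫ z in rightHalfPlane, (f z * (Φ (boundedChart z) : ℂ) - f z * (p (boundedChart z) : ℂ)) := by
    have := integral_sub (hi ⟨Φ, hΦ⟩) (hi p)
    rw [hpoly p hp, sub_zero] at this
    exact this.symm
  rw [e, zero_add]
  calc _ ≤ ∫ z in rightHalfPlane, ‖f z‖ * (ε / (I + 1)) := by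
        refine norm_integral_le_of_norm_le (hf.norm.mul_const _) ?_
        filter_upwards with z
        rw [← mul_sub, norm_mul]
        refine mul_le_mul_of_nonneg_left ?_ (norm_nonneg _)
        rw [norm_sub_rev, ← Complex.ofReal_sub, Complex.norm_real]
        exact (hpΦ _ (boundedChart_mem_closedBall z)).le
    _ = I * (ε / (I + 1)) := by rw [integral_mul_const]
    _ ≤ ε := by
        rw [mul_div_assoc', div_le_iff₀ (by positivity)]
        nlinarith

/-- Continuous functions with compact support in the half-plane are continuous functions of the
chart. -/
theorem exists_continuous_comp_boundedChart {φ : ℂ → ℝ} (hφ : Continuous φ)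
    (hc : HasCompactSupport φ) (hs : tsupport φ ⊆ rightHalfPlane) :
    ∃ Φ : ℂ → ℝ, Continuous Φ ∧ ∀ z ∈ rightHalfPlane, Φ (boundedChart z) = φ z := by
  -- `S` inverts the chart: `y = p.im / p.re` and `x² = 1 / p.re - 1 - y²`.
  set S : ℂ → ℂ := fun p => ⟨√(p.re⁻¹ - 1 - (p.im / p.re) ^ 2), p.im / p.re⟩ with hS
  have hcont : ∀ p : ℂ, 0 < p.re → ContinuousAt S p := by
    intro p hp
    have h1 : ContinuousAt (fun p : ℂ => p.re⁻¹) p := Complex.continuous_re.continuousAt.inv₀ hp.ne'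
    have h2 : ContinuousAt (fun p : ℂ => p.im / p.re) p :=
      Complex.continuous_im.continuousAt.div Complex.continuous_re.continuousAt hp.ne'
    have h3 : ContinuousAt (fun p : ℂ => √(p.re⁻¹ - 1 - (p.im / p.re) ^ 2)) p :=
      ((h1.sub continuousAt_const).sub (h2.pow 2)).sqrt
    exact Complex.equivRealProdCLM.symm.continuous.continuousAt.comp (h3.prodMk h2)
  obtain ⟨R, hR⟩ := hc.isCompact.isBounded.subset_closedBall (0 : ℂ)
  -- `φ ∘ S` is continuous across `p.re = 0` because it vanishes for small `p.re`: where the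
  -- argument of the root is not positive, `S p` lies on the axis, off the support of `φ`; elsewhere
  -- `|S p|² = 1 / p.re - 1 > R²`.
  have hzero : ∀ p : ℂ, p.re < (1 + R ^ 2)⁻¹ → φ (S p) = 0 := by
    intro p hp
    by_contra hne
    have hmem := subset_tsupport φ (Function.mem_support.2 hne)
    have hpos : 0 < (S p).re := hs hmem
    have hle := mem_closedBall_zero_iff.1 (hR hmem)
    have harg : 0 < p.re⁻¹ - 1 - (p.im / p.re) ^ 2 := Real.sqrt_pos.1 hpos
    have hinv : 0 < p.re⁻¹ := by nlinarith [sq_nonneg (p.im / p.re)]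
    have hn : Complex.normSq (S p) = p.re⁻¹ - 1 := by
      rw [Complex.normSq_apply]
      simp only [hS]
      rw [Real.mul_self_sqrt harg.le]; ring
    have hle2 : Complex.normSq (S p) ≤ R ^ 2 := by
      rw [Complex.normSq_eq_norm_sq]; gcongr
    have h1 : p.re⁻¹ ≤ 1 + R ^ 2 := by linarith
    have h2 := inv_anti₀ hinv h1
    rw [inv_inv] at h2
    linarith
  refine ⟨fun p => φ (S p), continuous_iff_continuousAt.2 fun p => ?_, fun z hz => ?_⟩
  · rcases lt_or_ge 0 p.re with hp | hp
    · exact hφ.continuousAt.comp (hcont p hp)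
    · have hlt : p.re < (1 + R ^ 2)⁻¹ := hp.trans_lt (by positivity)
      have : (fun p => φ (S p)) =ᶠ[𝓝 p] fun _ => 0 := by
        filter_upwards [(isOpen_lt Complex.continuous_re continuous_const).mem_nhds hlt] with q hq
          using hzero q hq
      exact continuousAt_const.congr this.symm
  · have hz' : 0 < z.re := hz
    have hQ : 1 + Complex.normSq z ≠ 0 := by linarith [Complex.normSq_nonneg z]
    have him : z.im * (1 + Complex.normSq z)⁻¹ / (1 + Complex.normSq z)⁻¹ = z.im := by
      field_simp
    have : S (boundedChart z) = z := by
      apply Complex.ext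
      · simp only [hS, boundedChart]
        rw [him, inv_inv, Complex.normSq_apply,
          show 1 + (z.re * z.re + z.im * z.im) - 1 - z.im ^ 2 = z.re * z.re by ring,
          Real.sqrt_mul_self hz'.le]
      · simp only [hS, boundedChart]
        exact him
    simp only [this]

/-- A monomial in the chart only shifts the indices of the density, and the shifted pair always lies
in the range `j ≤ a + j` where the moments are known to vanish. -/
theorem momentDensity_mul_boundedChart {κ k : ℂ} (u : ℂ → ℂ) (a j : ℕ) (z : ℂ) :
    momentDensity κ k u 0 2 z * (((boundedChart z).re ^ a * (boundedChart z).im ^ j : ℝ) : ℂ)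
      = momentDensity κ k u j (a + j + 2) z := by
  have hQ : ((1 + Complex.normSq z : ℝ) : ℂ) ≠ 0 := by
    have : 1 + Complex.normSq z ≠ 0 := by linarith [Complex.normSq_nonneg z]
    exact_mod_cast this
  have e : -(k / 2 + ((a + j + 2 : ℕ) : ℂ)) = -(k / 2 + (2 : ℕ)) - ((a + j : ℕ) : ℂ) := by
    push_cast; ring
  simp only [momentDensity, boundedChart]
  rw [e, Complex.cpow_sub _ _ hQ, Complex.cpow_natCast]
  rw [Complex.ofReal_mul, Complex.ofReal_pow, Complex.ofReal_pow, Complex.ofReal_mul,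
    Complex.ofReal_inv]
  generalize ((1 + Complex.normSq z : ℝ) : ℂ) ^ (-(k / 2 + (2 : ℕ))) = G
  generalize ((1 + Complex.normSq z : ℝ) : ℂ) = Q at hQ
  simp only [pow_add, mul_pow, inv_pow]
  field_simp

/-! ### Conclusion -/

/-- A solution of `L_m u = 0` vanishing at the boundary is zero, given the exponents `κ`, `k` of
the adjoint equation. -/
theorem eq_zero_of_adjoint_exponent {m κ k : ℂ} (hκ : (κ - 1) * (κ - m) = 0)
    (hk : k = 2 * κ - m) (hre : 1 ≤ κ.re) (hκk : κ.re ≤ k.re) {u : ℂ → ℂ}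
    (hu : ContDiffOn ℝ 2 u rightHalfPlane) (hL : ∀ z ∈ rightHalfPlane, weinsteinOp m u z = 0)
    (hlim : TendsToZeroAtBoundary u) : ∀ z ∈ rightHalfPlane, u z = 0 := by
  have hH := isOpen_rightHalfPlane
  obtain ⟨M, hM0, hM⟩ := hlim.bounded hu.continuousOn
  have hf : IntegrableOn (momentDensity κ k u 0 2) rightHalfPlane :=
    integrableOn_momentDensity (by linarith) hκk hu.continuousOn hM0.le hM le_rfl
  have cf := continuousOn_momentDensity (κ := κ) (k := k) hu.continuousOn 0 2
  have hmom : ∀ a j : ℕ, ∫ z in rightHalfPlane, momentDensity κ k u 0 2 z *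
      (((boundedChart z).re ^ a * (boundedChart z).im ^ j : ℝ) : ℂ) = 0 := by
    intro a j
    simp only [momentDensity_mul_boundedChart]
    exact integral_momentDensity_eq_zero hκ hk hre hκk hu hL hlim j (a + j) (by omega)
  have hae : ∀ᵐ z ∂(volume : Measure ℂ), z ∈ rightHalfPlane → momentDensity κ k u 0 2 z = 0 := by
    refine hH.ae_eq_zero_of_integral_contDiff_smul_eq_zero hf.locallyIntegrableOn ?_
    intro φ hφ hc hs
    obtain ⟨Φ, hΦ, he⟩ := exists_continuous_comp_boundedChart hφ.continuous hc hs
    rw [← setIntegral_eq_integral_of_forall_compl_eq_zero (s := rightHalfPlane) fun z hz => by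
      rw [image_eq_zero_of_notMem_tsupport fun h => hz (hs h), zero_smul],
      ← integral_mul_comp_boundedChart_eq_zero hf hmom hΦ]
    refine setIntegral_congr_fun hH.measurableSet fun z hz => ?_
    simp only [he z hz, Complex.real_smul, mul_comm]
  -- Continuity upgrades vanishing almost everywhere to vanishing everywhere; the factors `x^κ` and
  -- `Q^(-(k/2 + 2))` have no zeros.
  have heq : EqOn (momentDensity κ k u 0 2) (fun _ => 0) rightHalfPlane :=
    Measure.eqOn_open_of_ae_eq ((ae_restrict_iff' hH.measurableSet).2 hae) hH cf continuousOn_const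
  intro z hz
  have h := heq hz
  have hQ : ((1 + Complex.normSq z : ℝ) : ℂ) ≠ 0 := by
    have : 1 + Complex.normSq z ≠ 0 := by linarith [Complex.normSq_nonneg z]
    exact_mod_cast this
  simp only [momentDensity, pow_zero, one_mul, mul_eq_zero] at h
  rcases h with (h | h) | h
  · exact h
  · exact absurd ((Complex.cpow_eq_zero_iff _ _).1 h).1 (ofReal_re_ne_zero hz)
  · exact absurd ((Complex.cpow_eq_zero_iff _ _).1 h).1 hQ

theorem mainTheorem2 (m : ℂ) (u : ℂ → ℂ)
    (hu : ContDiffOn ℝ 2 u rightHalfPlane)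
    (hL : ∀ z ∈ rightHalfPlane, weinsteinOp m u z = 0)
    (hlim : TendsToZeroAtBoundary u) :
    ∀ z ∈ rightHalfPlane, u z = 0 := by
  -- The root of `(κ - 1)(κ - m)` with the larger real part is chosen: then `Re κ ≥ 1`, and `k - κ =
  -- κ - m` has nonnegative real part.
  rcases le_total 1 m.re with h | h
  · refine eq_zero_of_adjoint_exponent (κ := m) (k := m) ?_ ?_ h le_rfl hu hL hlim <;> ring
  · refine eq_zero_of_adjoint_exponent (κ := 1) (k := 2 - m) ?_ ?_ ?_ ?_ hu hL hlim
    · ring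
    · ring
    · simp
    · simp only [Complex.one_re, Complex.sub_re, Complex.re_ofNat]
      linarith
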